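/- A \emph{positively ordered monoid} is an abelian monoid $S$, written additively, with a partial order such that $0\le a$ for all $a$, and $a\le b$ implies $a+c\le b+c$. For $a,b$ in $S$ write $a\ll b$ if for every increasing sequence $(c_n)_n$ in $S$ with supremum $\sup_n c_n$, $b\le\sup_n c_n$ implies $a\le c_k$ for some $k$. A \emph{Cu-semigroup} is a positively ordered monoid such that (O1) every increasing sequence has a supremum; (O2) every element is the supremum of a sequence $(a_n)_n$ with $a_n\ll a_{n+1}$ for all $n$; (O3) $a'\ll a$ and $b'\ll b$ imply $a'+b'\ll a+b$; (O4) $\sup_n(a_n+b_n)=\sup_n a_n+\sup_n b_n$ for increasing sequences. A \emph{Cu-morphism} is an order-preserving monoid homomorphism that preserves $\ll$ and suprema of increasing sequences. A \emph{Cu-bimorphism} $f\colon S\times T\to R$ is a map that is an order-preserving monoid homomorphism in each variable, with $f(\sup_k a_k,\sup_k b_k)=\sup_k f(a_k,b_k)$ for increasing sequences, and $f(a',b')\ll f(a,b)$ whenever $a'\ll a$ and $b'\ll b$. The tensor product $S\otimes_{\mathrm{Cu}}T$ in the category of Cu-semigroups and Cu-morphisms represents Cu-bimorphisms: it is the completion,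 by $\prec$-increasing sequences, of the tensor product of the underlying positively ordered monoids, where $\prec$ is the auxiliary relation generated by $\sum_i a_i'\otimes b_i'\prec\sum_i a_i\otimes b_i$ for finitely many $a_i'\ll a_i$, $b_i'\ll b_i$. Let $Z=\mathbb{N}\sqcup(0,\infty]$ be the Cuntz semiring of the Jiang--Su algebra. Here $\mathbb{N}$ (with $0\in\mathbb{N}$) is the compact part and $(0,\infty]$ the soft part; addition, multiplication and order are the usual ones in each part; for a nonzero $n\in\mathbb{N}$ with associated soft element $n'\in(0,\infty]$, and $a\in(0,\infty]$, one has $n+a=n'+a$, $na=n'a$, $n\le a$ if and only if $n'<a$, and $a\le n$ if and only if $a\le n'$; and $0\in\mathbb{N}$ is the zero and least element of $Z$. A Cu-semigroup $S$ has \emph{$Z$-multiplication} if there is a Cu-bimorphism $Z\times S\to S$, $(z,s)\mapsto zs$, with $(z_1z_2)s=z_1(z_2s)$ and $1s=s$ for all $z_1,z_2\in Z$ and $s\in S$. It is \emph{almost unperforated} if for all $a,b\in S$, $(k+1)a\le kb$ for some $k\in\mathbb{N}$ implies $a\le b$. It is \emph{almost divisible} if for all $a\in S$, all $a'\ll a$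 and all integers $k\ge1$ there is $x\in S$ with $kx\le a$ and $a'\le(k+1)x$. \textbf{Theorem.} Let $S$ be a Cu-semigroup. Then the following are equivalent: (1) $S\cong Z\otimes_{\mathrm{Cu}}S$ as Cu-semigroups; (2) $S$ has $Z$-multiplication; (3) $S$ is almost unperforated and almost divisible. -/

import Mathlib

open scoped TensorProduct ENNReal

namespace Cuntz

/-! ### Compact containment and Cu-semigroups -/

/-- Compact containment `a ≪ b` in a partially ordered set (sequential version): whenever `b` lies
below the supremum of an increasing sequence, `a` lies below some member of that sequence. -/
def WayBelow {S : Type*} [PartialOrder S] (a b : S) : Prop :=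
  ∀ (c : ℕ → S) (s : S), Monotone c → IsLUB (Set.range c) s → b ≤ s → ∃ k, a ≤ c k

/-- A Cu-semigroup: a positively ordered (abelian) monoid satisfying the axioms (O1)-(O4). -/
class CuSemigroup (S : Type*) [AddCommMonoid S] [PartialOrder S] : Prop where
  add_le_add_right' : ∀ a b c : S, a ≤ b → a + c ≤ b + c
  zero_le' : ∀ a : S, 0 ≤ a
  /-- (O1) every increasing sequence has a supremum -/
  exists_sup : ∀ a : ℕ → S, Monotone a → ∃ s, IsLUB (Set.range a) s
  /-- (O2) every element is the supremum of a rapidly increasing sequence -/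
  exists_rapid : ∀ a : S, ∃ u : ℕ → S, (∀ n, WayBelow (u n) (u (n + 1))) ∧ IsLUB (Set.range u) a
  /-- (O3) addition preserves compact containment -/
  add_wayBelow : ∀ a' a b' b : S, WayBelow a' a → WayBelow b' b → WayBelow (a' + b') (a + b)
  /-- (O4) addition preserves suprema of increasing sequences -/
  add_sup : ∀ (a b : ℕ → S) (x y : S), Monotone a → Monotone b →
    IsLUB (Set.range a) x → IsLUB (Set.range b) y → IsLUB (Set.range fun n => a n + b n) (x + y)

/-- A Cu-morphism: an order-preserving monoid homomorphism that preserves compact containment and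
suprema of increasing sequences. -/
structure IsCuMorphism {S T : Type*} [AddCommMonoid S] [PartialOrder S] [AddCommMonoid T]
    [PartialOrder T] (f : S → T) : Prop where
  map_zero : f 0 = 0
  map_add : ∀ a b, f (a + b) = f a + f b
  monotone : Monotone f
  map_wayBelow : ∀ a' a, WayBelow a' a → WayBelow (f a') (f a)
  map_sup : ∀ (a : ℕ → S) (x : S), Monotone a → IsLUB (Set.range a) x →
    IsLUB (Set.range fun n => f (a n)) (f x)

/-- Isomorphism in the category Cu: there are mutually inverse Cu-morphisms. -/
def CuIsomorphic (S T : Type*) [AddCommMonoid S] [PartialOrder S] [AddCommMonoid T]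
    [PartialOrder T] : Prop :=
  ∃ (f : S → T) (g : T → S), IsCuMorphism f ∧ IsCuMorphism g ∧
    Function.LeftInverse g f ∧ Function.RightInverse g f

/-- A Cu-bimorphism `S × T → R`: an order-preserving monoid homomorphism in each variable that
is jointly compatible with suprema of increasing sequences and with compact containment. -/
structure IsCuBimorphism {S T R : Type*} [AddCommMonoid S] [PartialOrder S] [AddCommMonoid T]
    [PartialOrder T] [AddCommMonoid R] [PartialOrder R] (f : S → T → R) : Prop where
  zero_left : ∀ b, f 0 b = 0
  zero_right : ∀ a, f a 0 = 0
  add_left : ∀ a₁ a₂ b, f (a₁ + a₂) b = f a₁ b + f a₂ b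
  add_right : ∀ a b₁ b₂, f a (b₁ + b₂) = f a b₁ + f a b₂
  mono_left : ∀ a₁ a₂ b, a₁ ≤ a₂ → f a₁ b ≤ f a₂ b
  mono_right : ∀ a b₁ b₂, b₁ ≤ b₂ → f a b₁ ≤ f a b₂
  map_sup : ∀ (a : ℕ → S) (b : ℕ → T) (x : S) (y : T), Monotone a → Monotone b →
    IsLUB (Set.range a) x → IsLUB (Set.range b) y → IsLUB (Set.range fun n => f (a n) (b n)) (f x y)
  map_wayBelow : ∀ a' a b' b, WayBelow a' a → WayBelow b' b → WayBelow (f a' b') (f a b)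

/-- A Cu-semiring: a Cu-semigroup with a commutative, associative and unital product that is a
Cu-bimorphism. -/
class CuSemiring (R : Type*) [CommSemiring R] [PartialOrder R] : Prop extends CuSemigroup R where
  isCuBimorphism_mul : IsCuBimorphism fun a b : R => a * b

/-- `S` has `R`-multiplication: there is a Cu-bimorphism `(r, s) ↦ r s` from `R × S` to `S` with
`(r₁ r₂) s = r₁ (r₂ s)` and `1 s = s`. -/
def HasMultiplication (R S : Type*) [CommSemiring R] [PartialOrder R] [CuSemiring R]
    [AddCommMonoid S] [PartialOrder S] [CuSemigroup S] : Prop :=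
  ∃ f : R → S → S, IsCuBimorphism f ∧ (∀ r₁ r₂ s, f (r₁ * r₂) s = f r₁ (f r₂ s)) ∧ ∀ s, f 1 s = s

/-- Almost unperforation: `a ≤ b` whenever `(k + 1) a ≤ k b` for some `k`. -/
def AlmostUnperforated (S : Type*) [AddCommMonoid S] [PartialOrder S] : Prop :=
  ∀ a b : S, (∃ k : ℕ, (k + 1) • a ≤ k • b) → a ≤ b

/-- Almost divisibility: for all `k ≥ 1` and `a' ≪ a` there is `x` with `k x ≤ a` and
`a' ≤ (k + 1) x`. -/
def AlmostDivisible (S : Type*) [AddCommMonoid S] [PartialOrder S] : Prop :=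
  ∀ a : S, ∀ k : ℕ, 1 ≤ k → ∀ a' : S, WayBelow a' a → ∃ x : S, k • x ≤ a ∧ a' ≤ (k + 1) • x

/-! ### The tensor product of Cu-semigroups

It is the Cu-completion, by `≺`-increasing sequences, of the tensor product `S ⊗[ℕ] T` of the
underlying commutative monoids, equipped with the pre-order and the auxiliary relation `≺` that are
induced by the order and by compact containment of the factors. (The pre-order need not be made
antisymmetric first: `≺` is invariant under it, so the completion is the same.) -/

section Tensor

variable (S T : Type*) [AddCommMonoid S] [PartialOrder S] [AddCommMonoid T] [PartialOrder T]

variable {S T} in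
/-- The pre-order on the tensor product of the monoids `S` and `T`: the smallest additive pre-order
for which all elements are positive and `a ⊗ b` is increasing in both variables. -/
inductive TensorLE : S ⊗[ℕ] T → S ⊗[ℕ] T → Prop
  | refl (x) : TensorLE x x
  | trans {x y z} : TensorLE x y → TensorLE y z → TensorLE x z
  | add {x x' y y'} : TensorLE x y → TensorLE x' y' → TensorLE (x + x') (y + y')
  | zero_le (x) : TensorLE 0 x
  | tmul {a a' : S} {b b' : T} : a ≤ a' → b ≤ b' → TensorLE (a ⊗ₜ b) (a' ⊗ₜ b')

variable {S T} in
/-- The auxiliary relation on the tensor product: `x ≺ y` if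
`x ≤ ∑ a'ᵢ ⊗ b'ᵢ` and `∑ aᵢ ⊗ bᵢ ≤ y` for finitely many `a'ᵢ ≪ aᵢ` and `b'ᵢ ≪ bᵢ`. -/
def TensorPrec (x y : S ⊗[ℕ] T) : Prop :=
  ∃ (n : ℕ) (a' a : Fin n → S) (b' b : Fin n → T),
    (∀ i, WayBelow (a' i) (a i)) ∧ (∀ i, WayBelow (b' i) (b i)) ∧
    TensorLE x (∑ i, a' i ⊗ₜ[ℕ] b' i) ∧ TensorLE (∑ i, a i ⊗ₜ[ℕ] b i) y

variable {S T}

theorem WayBelow.le {P : Type*} [PartialOrder P] {a b : P} (h : WayBelow a b) : a ≤ b := by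
  obtain ⟨k, hk⟩ := h (fun _ => b) b monotone_const (by simp [Set.range_const]) le_rfl
  exact hk

theorem TensorLE.sum {n : ℕ} {x y : Fin n → S ⊗[ℕ] T} (h : ∀ i, TensorLE (x i) (y i)) :
    TensorLE (∑ i, x i) (∑ i, y i) := by
  induction n with
  | zero => simpa using TensorLE.refl _
  | succ n ih =>
    rw [Fin.sum_univ_succ, Fin.sum_univ_succ]
    exact (h 0).add (ih fun i => h i.succ)

theorem TensorPrec.le {x y : S ⊗[ℕ] T} (h : TensorPrec x y) : TensorLE x y := by
  obtain ⟨n, a', a, b', b, ha, hb, h₁, h₂⟩ := h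
  exact h₁.trans ((TensorLE.sum fun i => .tmul (ha i).le (hb i).le).trans h₂)

theorem TensorPrec.trans_le {x y z : S ⊗[ℕ] T} (h : TensorPrec x y) (h' : TensorLE y z) :
    TensorPrec x z := by
  obtain ⟨n, a', a, b', b, ha, hb, h₁, h₂⟩ := h
  exact ⟨n, a', a, b', b, ha, hb, h₁, h₂.trans h'⟩

theorem TensorPrec.trans {x y z : S ⊗[ℕ] T} (h : TensorPrec x y) (h' : TensorPrec y z) :
    TensorPrec x z :=
  h.trans_le h'.le

theorem TensorPrec.zero (x : S ⊗[ℕ] T) : TensorPrec 0 x :=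
  ⟨0, Fin.elim0, Fin.elim0, Fin.elim0, Fin.elim0, fun i => i.elim0, fun i => i.elim0,
    .zero_le _, by simpa using TensorLE.zero_le x⟩

theorem TensorPrec.add {x x' y y' : S ⊗[ℕ] T} (h : TensorPrec x y) (h' : TensorPrec x' y') :
    TensorPrec (x + x') (y + y') := by
  obtain ⟨n, a', a, b', b, ha, hb, h₁, h₂⟩ := h
  obtain ⟨m, c', c, d', d, hc, hd, h₃, h₄⟩ := h'
  refine ⟨n + m, Fin.append a' c', Fin.append a c, Fin.append b' d', Fin.append b d,
    fun i => ?_, fun i => ?_, ?_, ?_⟩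
  · refine Fin.addCases (fun i => ?_) (fun i => ?_) i <;> simp [ha, hc]
  · refine Fin.addCases (fun i => ?_) (fun i => ?_) i <;> simp [hb, hd]
  · simpa [Fin.sum_univ_add] using h₁.add h₃
  · simpa [Fin.sum_univ_add] using h₂.add h₄

variable (S T) in
/-- The `≺`-increasing sequences in the tensor product of the monoids `S` and `T`. -/
@[ext]
structure TensorSeq where
  seq : ℕ → S ⊗[ℕ] T
  prec_succ : ∀ k, TensorPrec (seq k) (seq (k + 1))

namespace TensorSeq

theorem prec_of_lt (x : TensorSeq S T) {k n : ℕ} (h : k < n) : TensorPrec (x.seq k) (x.seq n) := by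
  induction n, h using Nat.le_induction with
  | base => exact x.prec_succ k
  | succ n _ ih => exact ih.trans (x.prec_succ n)

/-- `x ⊂ y` if for every `k` there is `n` with `xₖ ≺ yₙ`. -/
instance : Preorder (TensorSeq S T) where
  le x y := ∀ k, ∃ n, TensorPrec (x.seq k) (y.seq n)
  le_refl x k := ⟨k + 1, x.prec_succ k⟩
  le_trans x y z h h' k := by
    obtain ⟨n, hn⟩ := h k
    obtain ⟨m, hm⟩ := h' n
    exact ⟨m, hn.trans hm⟩

/-- Sequences are added termwise. -/
instance : Add (TensorSeq S T) where
  add x y := ⟨fun k => x.seq k + y.seq k, fun k => (x.prec_succ k).add (y.prec_succ k)⟩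

instance : Zero (TensorSeq S T) where
  zero := ⟨fun _ => 0, fun _ => .zero _⟩

@[simp] theorem seq_add (x y : TensorSeq S T) (k : ℕ) : (x + y).seq k = x.seq k + y.seq k := rfl

@[simp] theorem seq_zero (k : ℕ) : (0 : TensorSeq S T).seq k = 0 := rfl

instance : AddCommMonoid (TensorSeq S T) where
  add_assoc x y z := by ext k; simp [add_assoc]
  zero_add x := by ext k; simp
  add_zero x := by ext k; simp
  add_comm x y := by ext k; simp [add_comm]
  nsmul := nsmulRec

theorem add_le_add' {x x' y y' : TensorSeq S T} (h : x ≤ y) (h' : x' ≤ y') : x + x' ≤ y + y' := by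
  intro k
  obtain ⟨n, hn⟩ := h k
  obtain ⟨m, hm⟩ := h' k
  exact ⟨max n m + 1, (hn.trans (y.prec_of_lt (by omega))).add (hm.trans (y'.prec_of_lt (by omega)))⟩

end TensorSeq

variable (S T) in
/-- The tensor product `S ⊗_Cu T`: the `≺`-increasing sequences in the algebraic tensor product
modulo `x ∼ y ↔ x ⊂ y ∧ y ⊂ x`, with the partial order induced by `⊂` and with the addition of
representatives. -/
def CuTensor : Type _ := Antisymmetrization (TensorSeq S T) (· ≤ ·)

instance : PartialOrder (CuTensor S T) :=
  inferInstanceAs (PartialOrder (Antisymmetrization (TensorSeq S T) (· ≤ ·)))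

/-- The class of a `≺`-increasing sequence. -/
def CuTensor.mk (x : TensorSeq S T) : CuTensor S T := toAntisymmetrization (· ≤ ·) x

instance : Add (CuTensor S T) where
  add := Quotient.map₂ (· + ·) fun _ _ h _ _ h' =>
    ⟨TensorSeq.add_le_add' h.1 h'.1, TensorSeq.add_le_add' h.2 h'.2⟩

instance : Zero (CuTensor S T) where
  zero := CuTensor.mk 0

instance : AddCommMonoid (CuTensor S T) where
  add_assoc x y z := by
    induction x using Quotient.inductionOn
    induction y using Quotient.inductionOn
    induction z using Quotient.inductionOn
    exact congrArg CuTensor.mk (add_assoc _ _ _)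
  zero_add x := by
    induction x using Quotient.inductionOn
    exact congrArg CuTensor.mk (zero_add _)
  add_zero x := by
    induction x using Quotient.inductionOn
    exact congrArg CuTensor.mk (add_zero _)
  add_comm x y := by
    induction x using Quotient.inductionOn
    induction y using Quotient.inductionOn
    exact congrArg CuTensor.mk (add_comm _ _)
  nsmul := nsmulRec

end Tensor

/-! ### The Cuntz semiring `Z = ℕ ⊔ (0, ∞]` of the Jiang-Su algebra -/

/-- The disjoint union of `ℕ` (the compact elements) and `(0, ∞]` (the soft elements). -/
inductive JiangSu : Type
  | compact (n : ℕ)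
  | soft (t : ℝ≥0∞) (ht : t ≠ 0)

namespace JiangSu

/-- A compact `m` lies below a soft `t` iff `m < t`; a soft `s` lies below a compact `n` iff
`s ≤ n`; the order in each of the two parts is the usual one. -/
protected def LE : JiangSu → JiangSu → Prop
  | compact m, compact n => m ≤ n
  | compact m, soft t _ => (m : ℝ≥0∞) < t
  | soft s _, compact n => s ≤ n
  | soft s _, soft t _ => s ≤ t

instance : LE JiangSu := ⟨JiangSu.LE⟩

instance : Zero JiangSu := ⟨compact 0⟩

instance : One JiangSu := ⟨compact 1⟩

/-- The usual addition in both parts; the soft part is absorbing. -/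
noncomputable instance : Add JiangSu where
  add
    | compact m, compact n => compact (m + n)
    | compact m, soft t ht => soft (m + t) (by simp [ht])
    | soft s hs, compact n => soft (s + n) (by simp [hs])
    | soft s hs, soft t _ => soft (s + t) (by simp [hs])

/-- The usual multiplication in both parts; the soft part is absorbing for nonzero elements. -/
noncomputable instance : Mul JiangSu where
  mul
    | compact m, compact n => compact (m * n)
    | compact 0, soft _ _ => compact 0
    | compact (m + 1), soft t ht => soft ((m + 1 : ℕ) * t) (mul_ne_zero (by simp) ht)
    | soft _ _, compact 0 => compact 0
    | soft s hs, compact (n + 1) => soft (s * (n + 1 : ℕ)) (mul_ne_zero hs (by simp))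
    | soft s hs, soft t ht => soft (s * t) (mul_ne_zero hs ht)

/-- The number in `[0, ∞]` underlying an element of `Z`. -/
def val : JiangSu → ℝ≥0∞
  | compact n => n
  | soft t _ => t

/-- Whether an element of `Z` belongs to the soft part. -/
def IsSoft : JiangSu → Prop
  | compact _ => False
  | soft _ _ => True

theorem ext' {x y : JiangSu} (h : x.val = y.val) (h' : x.IsSoft ↔ y.IsSoft) : x = y := by
  cases x <;> cases y <;> simp_all [val, IsSoft]

@[simp] theorem val_zero : (0 : JiangSu).val = 0 := by change ((0 : ℕ) : ℝ≥0∞) = 0; simp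

@[simp] theorem val_one : (1 : JiangSu).val = 1 := by change ((1 : ℕ) : ℝ≥0∞) = 1; simp

@[simp] theorem not_isSoft_zero : ¬(0 : JiangSu).IsSoft := fun h => h

@[simp] theorem not_isSoft_one : ¬(1 : JiangSu).IsSoft := fun h => h

@[simp] theorem val_add (x y : JiangSu) : (x + y).val = x.val + y.val := by
  cases x <;> cases y <;> first | exact Nat.cast_add _ _ | rfl

@[simp] theorem isSoft_add (x y : JiangSu) : (x + y).IsSoft ↔ x.IsSoft ∨ y.IsSoft := by
  rcases x with m | ⟨s, hs⟩ <;> rcases y with n | ⟨t, ht⟩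
  · change False ↔ False ∨ False; simp
  · change True ↔ False ∨ True; simp
  · change True ↔ True ∨ False; simp
  · change True ↔ True ∨ True; simp

@[simp] theorem val_mul (x y : JiangSu) : (x * y).val = x.val * y.val := by
  rcases x with (_ | m) | ⟨s, hs⟩ <;> rcases y with (_ | n) | ⟨t, ht⟩ <;>
    first | exact Nat.cast_mul _ _ | rfl | skip
  · change ((0 : ℕ) : ℝ≥0∞) = ((0 : ℕ) : ℝ≥0∞) * t; simp
  · change ((0 : ℕ) : ℝ≥0∞) = s * ((0 : ℕ) : ℝ≥0∞); simp

theorem val_eq_zero {x : JiangSu} : x.val = 0 ↔ x = 0 := by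
  refine ⟨fun h => ?_, by rintro rfl; simp⟩
  rcases x with m | ⟨s, hs⟩
  · refine ext' (by simpa using h) (by simp [IsSoft])
  · exact (hs h).elim

theorem val_ne_zero {x : JiangSu} (h : x.IsSoft) : x.val ≠ 0 := by
  rintro h'
  rw [val_eq_zero] at h'
  exact not_isSoft_zero (h' ▸ h)

@[simp] theorem isSoft_mul (x y : JiangSu) :
    (x * y).IsSoft ↔ (x.IsSoft ∨ y.IsSoft) ∧ x.val ≠ 0 ∧ y.val ≠ 0 := by
  rcases x with (_ | m) | ⟨s, hs⟩ <;> rcases y with (_ | n) | ⟨t, ht⟩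
  · change False ↔ (False ∨ False) ∧ _; simp
  · change False ↔ (False ∨ False) ∧ _; simp
  · change False ↔ (False ∨ True) ∧ ((0 : ℕ) : ℝ≥0∞) ≠ 0 ∧ _; simp
  · change False ↔ (False ∨ False) ∧ _; simp
  · change False ↔ (False ∨ False) ∧ _; simp
  · change True ↔ (False ∨ True) ∧ ((m + 1 : ℕ) : ℝ≥0∞) ≠ 0 ∧ t ≠ 0; simp [ht]
  · change False ↔ (True ∨ False) ∧ s ≠ 0 ∧ ((0 : ℕ) : ℝ≥0∞) ≠ 0; simp
  · change True ↔ (True ∨ False) ∧ s ≠ 0 ∧ ((n + 1 : ℕ) : ℝ≥0∞) ≠ 0; simp [hs]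
  · change True ↔ (True ∨ True) ∧ s ≠ 0 ∧ t ≠ 0; simp [hs, ht]

noncomputable instance : CommSemiring JiangSu where
  add_assoc x y z := ext' (by simp [add_assoc]) (by simp [or_assoc])
  zero_add x := ext' (by simp) (by simp)
  add_zero x := ext' (by simp) (by simp)
  add_comm x y := ext' (by simp [add_comm]) (by simp [or_comm])
  mul_assoc x y z := ext' (by simp [mul_assoc]) (by simp; tauto)
  zero_mul x := ext' (by simp) (by simp)
  mul_zero x := ext' (by simp) (by simp)
  one_mul x := ext' (by simp) (by have := @val_ne_zero x; simp; tauto)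
  mul_one x := ext' (by simp) (by have := @val_ne_zero x; simp; tauto)
  mul_comm x y := ext' (by simp [mul_comm]) (by simp; tauto)
  left_distrib x y z := ext' (by simp [mul_add]) (by
    have := @val_ne_zero x; have := @val_ne_zero y; have := @val_ne_zero z
    simp; tauto)
  right_distrib x y z := ext' (by simp [add_mul]) (by
    have := @val_ne_zero x; have := @val_ne_zero y; have := @val_ne_zero z
    simp; tauto)
  nsmul := nsmulRec
  npow := npowRec

/-- The order is lexicographic in the underlying number and in softness. -/
theorem le_iff {x y : JiangSu} :
    x ≤ y ↔ x.val < y.val ∨ x.val = y.val ∧ (y.IsSoft → x.IsSoft) := by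
  rcases x with m | ⟨s, hs⟩ <;> rcases y with n | ⟨t, ht⟩
  · change m ≤ n ↔ (m : ℝ≥0∞) < n ∨ (m : ℝ≥0∞) = n ∧ (False → False)
    simp [le_iff_lt_or_eq]
  · change (m : ℝ≥0∞) < t ↔ (m : ℝ≥0∞) < t ∨ (m : ℝ≥0∞) = t ∧ (True → False)
    simp
  · change s ≤ n ↔ s < n ∨ s = n ∧ (False → True)
    simp [le_iff_lt_or_eq]
  · change s ≤ t ↔ s < t ∨ s = t ∧ (True → True)
    simp [le_iff_lt_or_eq]

instance : PartialOrder JiangSu where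
  le_refl x := le_iff.2 (.inr ⟨rfl, id⟩)
  le_trans x y z h h' := by
    rw [le_iff] at *
    rcases h with h | ⟨h, h₁⟩ <;> rcases h' with h' | ⟨h', h₂⟩
    · exact .inl (h.trans h')
    · exact .inl (h' ▸ h)
    · exact .inl (h ▸ h')
    · exact .inr ⟨h.trans h', h₁ ∘ h₂⟩
  le_antisymm x y h h' := by
    rw [le_iff] at *
    rcases h with h | ⟨h, h₁⟩ <;> rcases h' with h' | ⟨h', h₂⟩
    · exact absurd h h'.asymm
    · exact absurd h h'.not_gt
    · exact absurd h' h.not_gt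
    · exact ext' h ⟨h₂, h₁⟩

theorem val_mono : Monotone val := fun x y h => by
  rcases le_iff.1 h with h | ⟨h, -⟩
  · exact h.le
  · exact h.le

theorem le_of_val_lt {x y : JiangSu} (h : x.val < y.val) : x ≤ y := le_iff.2 (.inl h)

theorem le_of_soft {x y : JiangSu} (hx : x.IsSoft) (h : x.val ≤ y.val) : x ≤ y :=
  le_iff.2 (h.lt_or_eq.imp_right fun h => ⟨h, fun _ => hx⟩)

theorem le_of_not_soft {x y : JiangSu} (hy : ¬y.IsSoft) (h : x.val ≤ y.val) : x ≤ y :=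
  le_iff.2 (h.lt_or_eq.imp_right fun h => ⟨h, fun h => (hy h).elim⟩)

theorem val_ne_top {x : JiangSu} (h : ¬x.IsSoft) : x.val ≠ ⊤ := by
  cases x
  · simp [val]
  · exact (h trivial).elim

/-- Suprema of increasing sequences in `Z`. -/
theorem isLUB_iff {a : ℕ → JiangSu} (ha : Monotone a) {x : JiangSu} :
    IsLUB (Set.range a) x ↔
      (∃ n, ∀ k, n ≤ k → a k = x) ∨ (x.IsSoft ∧ (∀ n, a n ≤ x) ∧ x.val = ⨆ n, (a n).val) := by
  constructor
  · intro h
    by_cases hx : ∃ n, a n = x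
    · obtain ⟨n, hn⟩ := hx
      exact .inl ⟨n, fun k hk => (h.1 ⟨k, rfl⟩).antisymm (hn ▸ ha hk)⟩
    · right
      have hle : ∀ n, a n ≤ x := fun n => h.1 ⟨n, rfl⟩
      have hv : (⨆ n, (a n).val) ≤ x.val := iSup_le fun n => val_mono (hle n)
      have h0 : (⨆ n, (a n).val) ≠ 0 := by
        intro h0
        have : ∀ n, a n = 0 := fun n => val_eq_zero.1 (by simpa using (iSup_eq_bot.1 h0) n)
        refine hx ⟨0, (hle 0).antisymm (h.2 ?_)⟩
        rintro _ ⟨n, rfl⟩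
        rw [this, this]
      by_cases hatt : ∃ n, (a n).val = (⨆ n, (a n).val) ∧ ¬(a n).IsSoft
      · obtain ⟨n, hn, hs⟩ := hatt
        refine (hx ⟨n, (hle n).antisymm (h.2 ?_)⟩).elim
        rintro _ ⟨m, rfl⟩
        exact le_of_not_soft hs (hn ▸ le_iSup (fun n => (a n).val) m)
      · have hub : x ≤ soft _ h0 := h.2 <| by
          rintro _ ⟨m, rfl⟩
          rcases (le_iSup (fun n => (a n).val) m).lt_or_eq with hlt | heq
          · exact le_of_val_lt hlt
          · push Not at hatt
            exact le_of_soft (hatt m heq) heq.le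
        have hval : x.val = ⨆ n, (a n).val := (val_mono hub).antisymm hv
        refine ⟨?_, hle, hval⟩
        rcases le_iff.1 hub with h | ⟨-, h⟩
        · exact absurd h hv.not_gt
        · exact h trivial
  · rintro (⟨n, hn⟩ | ⟨hs, hle, hv⟩)
    · refine ⟨?_, fun y hy => hn n le_rfl ▸ hy ⟨n, rfl⟩⟩
      rintro _ ⟨m, rfl⟩
      exact hn (max n m) (le_max_left _ _) ▸ ha (le_max_right _ _)
    · refine ⟨?_, fun y hy => le_of_soft hs ?_⟩
      · rintro _ ⟨m, rfl⟩
        exact hle m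
      · exact hv ▸ iSup_le fun n => val_mono (hy ⟨n, rfl⟩)

theorem val_isLUB {a : ℕ → JiangSu} (ha : Monotone a) {x : JiangSu} (h : IsLUB (Set.range a) x) :
    x.val = ⨆ n, (a n).val := by
  refine le_antisymm ?_ (iSup_le fun n => val_mono (h.1 ⟨n, rfl⟩))
  rcases (isLUB_iff ha).1 h with ⟨n, hn⟩ | ⟨-, -, h⟩
  · exact hn n le_rfl ▸ le_iSup (fun n => (a n).val) n
  · exact h.le

/-- Compact containment in `Z`. -/
theorem wayBelow_iff {x y : JiangSu} :
    WayBelow x y ↔ x ≤ y ∧ (y.IsSoft → x.val < y.val) := by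
  constructor
  · refine fun h => ⟨h.le, fun hy => ?_⟩
    obtain ⟨u, hu, hu0, hlim⟩ := exists_seq_strictMono_tendsto' (pos_iff_ne_zero.2 (val_ne_zero hy))
    have hm : Monotone fun n => soft (u n) (hu0 n).1.ne' :=
      fun i j hij => le_of_soft trivial (hu.monotone hij)
    obtain ⟨k, hk⟩ := h _ y hm ((isLUB_iff hm).2 (.inr ⟨hy, fun n => le_of_val_lt (hu0 n).2,
      (tendsto_nhds_unique (tendsto_atTop_iSup hu.monotone) hlim).symm⟩)) le_rfl
    exact (val_mono hk).trans_lt (hu0 k).2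
  · rintro ⟨hle, hs⟩ c s hc hlub hys
    rcases (isLUB_iff hc).1 hlub with ⟨n, hn⟩ | ⟨hss, -, hv⟩
    · exact ⟨n, hn n le_rfl ▸ hle.trans hys⟩
    · have : x.val < ⨆ n, (c n).val := by
        rw [← hv]
        by_cases hy : y.IsSoft
        · exact (hs hy).trans_le (val_mono hys)
        · rcases le_iff.1 hys with h | ⟨-, h⟩
          · exact (val_mono hle).trans_lt h
          · exact (hy (h hss)).elim
      obtain ⟨n, hn⟩ := lt_iSup_iff.1 this
      exact ⟨n, le_of_val_lt hn⟩

theorem val_ne_top_of_wayBelow {x y : JiangSu} (h : WayBelow x y) : x.val ≠ ⊤ := by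
  rw [wayBelow_iff] at h
  by_cases hy : y.IsSoft
  · exact (h.2 hy).ne_top
  · exact ne_top_of_le_ne_top (val_ne_top hy) (val_mono h.1)

theorem val_lt_of_le {x y : JiangSu} (h : x ≤ y) (hx : ¬x.IsSoft) (hy : y.IsSoft) :
    x.val < y.val := by
  rcases le_iff.1 h with h | ⟨-, h⟩
  · exact h
  · exact (hx (h hy)).elim

theorem zero_le' (x : JiangSu) : 0 ≤ x := by
  rcases eq_or_ne x.val 0 with h | h
  · rw [val_eq_zero.1 h]
  · exact le_of_val_lt (by simpa using pos_iff_ne_zero.2 h)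

theorem val_mul_lt {x x' y y' : JiangSu} (h : x.val < y.val) (h' : x' ≤ y') (ht : x'.val ≠ ⊤)
    (h0 : y'.val ≠ 0) : x.val * x'.val < y.val * y'.val := by
  rcases eq_or_ne x'.val 0 with hx | hx
  · rw [hx, mul_zero]
    exact pos_iff_ne_zero.2 (mul_ne_zero h.ne_bot h0)
  · exact (ENNReal.mul_lt_mul_left hx ht h).trans_le (mul_le_mul_right (val_mono h') _)

theorem add_mono {x x' y y' : JiangSu} (h : x ≤ y) (h' : x' ≤ y') : x + x' ≤ y + y' := by
  have hv : (x + x').val ≤ (y + y').val := by simpa using add_le_add (val_mono h) (val_mono h')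
  by_cases hs : (x + x').IsSoft
  · exact le_of_soft hs hv
  by_cases hs' : (y + y').IsSoft
  · simp only [isSoft_add, not_or] at hs hs'
    refine le_of_val_lt ?_
    rw [val_add, val_add]
    rcases hs' with hy | hy
    · exact ENNReal.add_lt_add_of_lt_of_le (val_ne_top hs.2) (val_lt_of_le h hs.1 hy) (val_mono h')
    · exact ENNReal.add_lt_add_of_le_of_lt (val_ne_top hs.1) (val_mono h) (val_lt_of_le h' hs.2 hy)
  · exact le_of_not_soft hs' hv

theorem mul_mono {x x' y y' : JiangSu} (h : x ≤ y) (h' : x' ≤ y') : x * x' ≤ y * y' := by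
  have hv : (x * x').val ≤ (y * y').val := by simpa using mul_le_mul' (val_mono h) (val_mono h')
  by_cases hs : (x * x').IsSoft
  · exact le_of_soft hs hv
  by_cases hs' : (y * y').IsSoft
  · by_cases h0 : x * x' = 0
    · rw [h0]
      exact zero_le' _
    have hx0 : x.val ≠ 0 := fun hx => h0 (by rw [val_eq_zero.1 hx, zero_mul])
    have hx0' : x'.val ≠ 0 := fun hx => h0 (by rw [val_eq_zero.1 hx, mul_zero])
    simp only [isSoft_mul, hx0, hx0', ne_eq, not_false_eq_true, and_true, not_or] at hs hs'
    refine le_of_val_lt ?_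
    rw [val_mul, val_mul]
    rcases hs'.1 with hy | hy
    · exact val_mul_lt (val_lt_of_le h hs.1 hy) h' (val_ne_top hs.2) hs'.2.2
    · rw [mul_comm, mul_comm y.val]
      exact val_mul_lt (val_lt_of_le h' hs.2 hy) h (val_ne_top hs.1) hs'.2.1
  · exact le_of_not_soft hs' hv

theorem exists_isLUB (a : ℕ → JiangSu) (ha : Monotone a) : ∃ s, IsLUB (Set.range a) s := by
  by_cases hatt : ∃ n, (a n).val = (⨆ n, (a n).val) ∧ ¬(a n).IsSoft
  · obtain ⟨n, hn, hs⟩ := hatt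
    refine ⟨a n, ?_, fun y hy => hy ⟨n, rfl⟩⟩
    rintro _ ⟨m, rfl⟩
    exact le_of_not_soft hs (hn ▸ le_iSup (fun n => (a n).val) m)
  · push Not at hatt
    have h0 : (⨆ n, (a n).val) ≠ 0 := fun h0 => by
      have h := (iSup_eq_bot.1 h0) 0
      exact val_ne_zero (hatt 0 (h.trans h0.symm)) h
    refine ⟨soft _ h0, (isLUB_iff ha).2 (.inr ⟨trivial, fun m => ?_, rfl⟩)⟩
    rcases (le_iSup (fun n => (a n).val) m).lt_or_eq with hlt | heq
    · exact le_of_val_lt hlt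
    · exact le_of_soft (hatt m heq) heq.le

theorem exists_rapid (x : JiangSu) :
    ∃ u : ℕ → JiangSu, (∀ n, WayBelow (u n) (u (n + 1))) ∧ IsLUB (Set.range u) x := by
  by_cases hx : x.IsSoft
  · obtain ⟨u, hu, hu0, hlim⟩ := exists_seq_strictMono_tendsto' (pos_iff_ne_zero.2 (val_ne_zero hx))
    have hm : Monotone fun n => soft (u n) (hu0 n).1.ne' :=
      fun i j hij => le_of_soft trivial (hu.monotone hij)
    exact ⟨_, fun n => wayBelow_iff.2 ⟨hm n.le_succ, fun _ => hu n.lt_succ_self⟩,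
      (isLUB_iff hm).2 (.inr ⟨hx, fun n => le_of_val_lt (hu0 n).2,
      (tendsto_nhds_unique (tendsto_atTop_iSup hu.monotone) hlim).symm⟩)⟩
  · exact ⟨fun _ => x, fun _ => wayBelow_iff.2 ⟨le_rfl, fun h => (hx h).elim⟩, by simp⟩

theorem add_sup {a b : ℕ → JiangSu} {x y : JiangSu} (ha : Monotone a) (hb : Monotone b)
    (hx : IsLUB (Set.range a) x) (hy : IsLUB (Set.range b) y) :
    IsLUB (Set.range fun n => a n + b n) (x + y) := by
  have hv : (x + y).val = ⨆ n, (a n + b n).val := by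
    rw [val_add, val_isLUB ha hx, val_isLUB hb hy, ENNReal.iSup_add_iSup_of_monotone
      (fun _ _ h => val_mono (ha h)) (fun _ _ h => val_mono (hb h))]
    simp
  have hle : ∀ n, a n + b n ≤ x + y := fun n => add_mono (hx.1 ⟨n, rfl⟩) (hy.1 ⟨n, rfl⟩)
  refine (isLUB_iff fun i j hij => add_mono (ha hij) (hb hij)).2 ?_
  rcases (isLUB_iff ha).1 hx with ⟨n, hn⟩ | ⟨hs, -⟩
  · rcases (isLUB_iff hb).1 hy with ⟨m, hm⟩ | ⟨hs, -⟩
    · exact .inl ⟨max n m, fun k hk => by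
        rw [hn k ((le_max_left _ _).trans hk), hm k ((le_max_right _ _).trans hk)]⟩
    · exact .inr ⟨by simp [hs], hle, hv⟩
  · exact .inr ⟨by simp [hs], hle, hv⟩

theorem mul_sup {a b : ℕ → JiangSu} {x y : JiangSu} (ha : Monotone a) (hb : Monotone b)
    (hx : IsLUB (Set.range a) x) (hy : IsLUB (Set.range b) y) :
    IsLUB (Set.range fun n => a n * b n) (x * y) := by
  have hle : ∀ n, a n * b n ≤ x * y := fun n => mul_mono (hx.1 ⟨n, rfl⟩) (hy.1 ⟨n, rfl⟩)
  have hv : (x * y).val = ⨆ n, (a n * b n).val := by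
    refine le_antisymm ?_ (iSup_le fun n => val_mono (hle n))
    rw [val_mul, val_isLUB ha hx, val_isLUB hb hy, ENNReal.iSup_mul]
    refine iSup_le fun i => ?_
    rw [ENNReal.mul_iSup]
    refine iSup_le fun j => le_iSup_of_le (max i j) ?_
    rw [val_mul]
    exact mul_le_mul' (val_mono (ha (le_max_left _ _))) (val_mono (hb (le_max_right _ _)))
  refine (isLUB_iff fun i j hij => mul_mono (ha hij) (hb hij)).2 ?_
  by_cases hx0 : x.val = 0
  · refine .inl ⟨0, fun k _ => (hle k).antisymm ?_⟩
    rw [val_eq_zero.1 hx0, zero_mul]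
    exact zero_le' _
  by_cases hy0 : y.val = 0
  · refine .inl ⟨0, fun k _ => (hle k).antisymm ?_⟩
    rw [val_eq_zero.1 hy0, mul_zero]
    exact zero_le' _
  rcases (isLUB_iff ha).1 hx with ⟨n, hn⟩ | ⟨hs, -⟩
  · rcases (isLUB_iff hb).1 hy with ⟨m, hm⟩ | ⟨hs, -⟩
    · exact .inl ⟨max n m, fun k hk => by
        rw [hn k ((le_max_left _ _).trans hk), hm k ((le_max_right _ _).trans hk)]⟩
    · exact .inr ⟨by simp [hs, hx0, hy0], hle, hv⟩
  · exact .inr ⟨by simp [hs, hx0, hy0], hle, hv⟩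

instance : CuSemiring JiangSu where
  add_le_add_right' _ _ _ h := add_mono h le_rfl
  zero_le' := zero_le'
  exists_sup := exists_isLUB
  exists_rapid := exists_rapid
  add_wayBelow x y x' y' h h' := by
    have ht := val_ne_top_of_wayBelow h
    have ht' := val_ne_top_of_wayBelow h'
    rw [wayBelow_iff] at *
    refine ⟨add_mono h.1 h'.1, fun hs => ?_⟩
    rw [val_add, val_add]
    rcases (isSoft_add _ _).1 hs with hy | hy
    · exact ENNReal.add_lt_add_of_lt_of_le ht' (h.2 hy) (val_mono h'.1)
    · exact ENNReal.add_lt_add_of_le_of_lt ht (val_mono h.1) (h'.2 hy)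
  add_sup _ _ _ _ ha hb hx hy := add_sup ha hb hx hy
  isCuBimorphism_mul :=
    { zero_left := zero_mul
      zero_right := mul_zero
      add_left := add_mul
      add_right := mul_add
      mono_left := fun _ _ _ h => mul_mono h le_rfl
      mono_right := fun _ _ _ h => mul_mono le_rfl h
      map_sup := fun _ _ _ _ ha hb hx hy => mul_sup ha hb hx hy
      map_wayBelow := fun x y x' y' h h' => by
        have ht := val_ne_top_of_wayBelow h
        have ht' := val_ne_top_of_wayBelow h'
        rw [wayBelow_iff] at *
        refine ⟨mul_mono h.1 h'.1, fun hs => ?_⟩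
        obtain ⟨hs, h0, h0'⟩ := (isSoft_mul _ _).1 hs
        rw [val_mul, val_mul]
        rcases hs with hy | hy
        · exact val_mul_lt (h.2 hy) h'.1 ht' h0'
        · rw [mul_comm, mul_comm y.val]
          exact val_mul_lt (h'.2 hy) h.1 ht h0 }

end JiangSu

end Cuntz

/-!
Multiplication by the soft elements `1 / k` is what makes a `Z`-action equivalent to almost
unperforation and almost divisibility. Since `k (1 / k) ≤ 1 ≤ (k + 1) (1 / k)` in `Z`, acting by
`1 / k` on `(k + 1) a ≤ k b` gives `a ≤ b`, and `(1 / k) a` is a witness of almost divisibility.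
This applies to a Cu-semigroup with `Z`-multiplication, and equally to the algebraic tensor product
`Z ⊗ S`, hence to its completion (`TensorLE.of_nsmul`, `CuTensor.exists_nsmul_le`).

Conversely, let `S` be almost unperforated and almost divisible. The product of a soft `t` with `a`
is determined by the elements compactly contained in it: `x ≪ t a` if and only if `q x ≪ p a` for
some fraction `p / q < t`. Almost divisibility provides a countable family `y` that approximates
`(r / k) a'` for `r / k < t` and `a' ≪ a`; almost unperforation turns the strict inequality between
fractions into comparisons of `x` with `y` (`AlmostUnperforated.wayBelow_of_nsmul_le`), so that the
family is directed and has a supremum with the required property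
(`exists_wayBelow_iff_softBelow`). The axioms of a `Z`-multiplication are then checked on
compactly contained elements.

Finally, let `S` have `Z`-multiplication. If `z < w` in value, there is a compact `p` with
`(k + 1) z ≤ p ≤ k w`. As compact elements can be moved across the tensor sign, almost
unperforation of `Z ⊗ S` gives `z ⊗ s ≤ 1 ⊗ w s` and `1 ⊗ z s ≤ w ⊗ s` (`tensorLE_one_tmul`,
`one_tmul_tensorLE`). So every `≺`-increasing sequence in `Z ⊗ S` is equivalent to one of the form
`1 ⊗ vₙ`, and `s ↦ 1 ⊗ s` is an additive order isomorphism from `S` to the completion.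
-/

open scoped Topology

namespace Cuntz

/-! ### Compact containment in Cu-semigroups -/

theorem WayBelow.trans_le {P : Type*} [PartialOrder P] {a b c : P} (h : WayBelow a b)
    (h' : b ≤ c) : WayBelow a c :=
  fun u s hu hs hc => h u s hu hs (h'.trans hc)

theorem WayBelow.le_trans {P : Type*} [PartialOrder P] {a b c : P} (h : a ≤ b)
    (h' : WayBelow b c) : WayBelow a c :=
  fun u s hu hs hc => (h' u s hu hs hc).imp fun _ => h.trans

section Basic

variable {S : Type*} [AddCommMonoid S] [PartialOrder S] [CuSemigroup S]

instance : IsOrderedAddMonoid S where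
  add_le_add_left a b h c := CuSemigroup.add_le_add_right' a b c h

theorem WayBelow.add {a' a b' b : S} (h : WayBelow a' a) (h' : WayBelow b' b) :
    WayBelow (a' + b') (a + b) :=
  CuSemigroup.add_wayBelow _ _ _ _ h h'

theorem wayBelow_zero_left (a : S) : WayBelow 0 a :=
  fun _ _ _ _ _ => ⟨0, CuSemigroup.zero_le' _⟩

theorem WayBelow.nsmul {a b : S} (h : WayBelow a b) (n : ℕ) : WayBelow (n • a) (n • b) := by
  induction n with
  | zero => simpa using wayBelow_zero_left _
  | succ n ih => simpa only [succ_nsmul] using ih.add h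

/-- Every element `a` is the supremum of an increasing sequence in the set of all `x ≪ a`, and this
sequence is cofinal in that set for compact containment. -/
theorem exists_rapid_seq (a : S) : ∃ u : ℕ → S, Monotone u ∧ IsLUB (Set.range u) a ∧
    (∀ n, WayBelow (u n) a) ∧ ∀ x, WayBelow x a → ∃ n, WayBelow x (u n) := by
  obtain ⟨u, hu, ha⟩ := CuSemigroup.exists_rapid a
  have hm : Monotone u := monotone_nat_of_le_succ fun n => (hu n).le
  refine ⟨u, hm, ha, fun n => (hu n).trans_le (ha.1 ⟨n + 1, rfl⟩), fun x hx => ?_⟩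
  obtain ⟨n, hn⟩ := hx u a hm ha le_rfl
  exact ⟨n + 1, (hu n).le_trans hn⟩

theorem WayBelow.interpolate {a b : S} (h : WayBelow a b) :
    ∃ c, WayBelow a c ∧ WayBelow c b := by
  obtain ⟨u, -, -, hub, hx⟩ := exists_rapid_seq b
  obtain ⟨n, hn⟩ := hx a h
  exact ⟨u n, hn, hub n⟩

theorem le_of_forall_wayBelow {a b : S} (h : ∀ x, WayBelow x a → x ≤ b) : a ≤ b := by
  obtain ⟨u, -, ha, hua, -⟩ := exists_rapid_seq a
  refine ha.2 ?_
  rintro _ ⟨n, rfl⟩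
  exact h _ (hua n)

/-- A sum lies below `c` as soon as the sums of elements compactly contained in the summands do. -/
theorem add_le_of_forall_wayBelow {a b c : S}
    (h : ∀ x y, WayBelow x a → WayBelow y b → x + y ≤ c) : a + b ≤ c := by
  obtain ⟨u, hu, ha, hua, -⟩ := exists_rapid_seq a
  obtain ⟨v, hv, hb, hvb, -⟩ := exists_rapid_seq b
  refine (CuSemigroup.add_sup u v a b hu hv ha hb).2 ?_
  rintro _ ⟨n, rfl⟩
  exact h _ _ (hua n) (hvb n)

theorem WayBelow.exists_add {a b x : S} (h : WayBelow x (a + b)) :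
    ∃ a' b', WayBelow a' a ∧ WayBelow b' b ∧ x ≤ a' + b' := by
  obtain ⟨u, hu, ha, hua, -⟩ := exists_rapid_seq a
  obtain ⟨v, hv, hb, hvb, -⟩ := exists_rapid_seq b
  obtain ⟨k, hk⟩ := h _ _ (fun i j hij => add_le_add (hu hij) (hv hij))
    (CuSemigroup.add_sup u v a b hu hv ha hb) le_rfl
  exact ⟨u k, v k, hua k, hvb k, hk⟩

theorem isLUB_nsmul {u : ℕ → S} {a : S} (hu : Monotone u) (h : IsLUB (Set.range u) a) (n : ℕ) :
    IsLUB (Set.range fun k => n • u k) (n • a) := by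
  induction n with
  | zero => simp
  | succ n ih =>
    simpa only [succ_nsmul] using
      CuSemigroup.add_sup _ _ _ _ (fun i j hij => nsmul_le_nsmul_right (hu hij) n) hu ih h

theorem WayBelow.exists_nsmul {x a : S} {n : ℕ} (h : WayBelow x (n • a)) :
    ∃ a', WayBelow a' a ∧ WayBelow x (n • a') := by
  obtain ⟨w, hxw, hw⟩ := h.interpolate
  obtain ⟨u, hu, ha, hua, -⟩ := exists_rapid_seq a
  obtain ⟨k, hk⟩ := hw _ _ (fun i j hij => nsmul_le_nsmul_right (hu hij) n) (isLUB_nsmul hu ha n)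
    le_rfl
  exact ⟨u k, hua k, hxw.trans_le hk⟩

theorem AlmostUnperforated.le (h : AlmostUnperforated S) {a b : S} {m n : ℕ} (hnm : n < m)
    (hab : m • a ≤ n • b) : a ≤ b :=
  h a b ⟨n, (nsmul_le_nsmul_left (CuSemigroup.zero_le' a) hnm).trans hab⟩

/-- Almost unperforation for compact containment: the inequality `m a ≤ n c k` holds for some
member `c k` of an increasing sequence whose supremum lies above `b`. -/
theorem AlmostUnperforated.wayBelow (h : AlmostUnperforated S) {a b : S} {m n : ℕ} (hnm : n < m)
    (hab : WayBelow (m • a) (n • b)) : WayBelow a b := fun c s hc hs hbs => by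
  obtain ⟨k, hk⟩ := hab _ _ (fun i j hij => nsmul_le_nsmul_right (hc hij) n) (isLUB_nsmul hc hs n)
    (nsmul_le_nsmul_right hbs n)
  exact ⟨k, h.le hnm hk⟩

/-- The hypotheses say `x ≪ (p / q) a` and `(r / l) a ≤ y` in terms of fractions; the conclusion
follows from `p / q < r / l`. -/
theorem AlmostUnperforated.wayBelow_of_nsmul_le (h : AlmostUnperforated S) {a x y : S}
    {p q r l : ℕ} (hlt : p * l < q * r) (hx : WayBelow (q • x) (p • a)) (hy : r • a ≤ l • y) :
    WayBelow x y := by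
  refine h.wayBelow (m := r * q) (n := p * l) (by rwa [mul_comm r]) ?_
  rw [mul_nsmul' x, mul_nsmul' y]
  refine (hx.nsmul r).trans_le ?_
  rw [← mul_nsmul', mul_comm, mul_nsmul']
  exact nsmul_le_nsmul_right hy p

theorem AlmostDivisible.exists_wayBelow (h : AlmostDivisible S) {a' a : S} (ha : WayBelow a' a)
    {k : ℕ} (hk : 1 ≤ k) (n : ℕ) :
    ∃ x, WayBelow (k • x) (n • a) ∧ n • a' ≤ (k + 1) • x := by
  obtain ⟨c, h₁, h₂⟩ := ha.interpolate
  obtain ⟨x, hx, hx'⟩ := h (n • c) k hk (n • a') (h₁.nsmul n)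
  exact ⟨x, (h₂.nsmul n).le_trans hx, hx'⟩

end Basic

/-! ### Approximation of extended nonnegative reals by fractions -/

/-- A property that holds near `s ≠ 0` holds at some fraction `a / b < s`. -/
theorem exists_nat_div_of_eventually {s : ℝ≥0∞} (hs : s ≠ 0) {p : ℝ≥0∞ → Prop}
    (hp : ∀ᶠ u in 𝓝 s, p u) : ∃ a b : ℕ, 0 < b ∧ (a : ℝ≥0∞) < b * s ∧ p (a / b) := by
  obtain ⟨l, hl, hlp⟩ := (mem_nhdsLT_iff_exists_Ioo_subset' (pos_iff_ne_zero.2 hs)).1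
    (nhdsWithin_le_nhds hp)
  obtain ⟨q, hq, hlq, hqs⟩ := ENNReal.lt_iff_exists_rat_btwn.1 (Set.mem_Iio.1 hl)
  have hq' : ((Real.toNNReal q : NNReal) : ℝ≥0∞) = (q.num.toNat : ℝ≥0∞) / q.den := by
    have h1 : Real.toNNReal q = (q.num.toNat : NNReal) / q.den := by
      ext
      rw [Real.coe_toNNReal _ (by exact_mod_cast hq)]
      have : ((q.num.toNat : ℤ) : ℝ) = q.num := by
        rw [Int.toNat_of_nonneg (Rat.num_nonneg.2 hq)]
      push_cast at this ⊢
      rw [this]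
      exact_mod_cast (Rat.num_div_den q).symm
    rw [h1, ENNReal.coe_div (by simp [q.den_nz])]
    simp
  rw [hq'] at hlq hqs
  refine ⟨q.num.toNat, q.den, q.den_pos, ?_, hlp ⟨hlq, hqs⟩⟩
  rw [mul_comm]
  exact (ENNReal.div_lt_iff (by simp [q.den_nz]) (by simp)).1 hqs

/-- If `p / q < n + t`, there is a fraction `r / k < t` with `p / q < n + r / (k + 1)`. The loss in
the denominator is the one incurred by almost divisibility. -/
theorem exists_nat_mul_lt {t : ℝ≥0∞} {p q n : ℕ} (h : (p : ℝ≥0∞) < q * (n + t)) (ht : t ≠ 0) :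
    ∃ r k : ℕ, (r : ℝ≥0∞) < k * t ∧ p * (k + 1) < q * (n * (k + 1) + r) := by
  have hc : ∀ᶠ u in 𝓝 t, (p : ℝ≥0∞) < q * (n + u) :=
    (ENNReal.Tendsto.const_mul (tendsto_const_nhds.add Filter.tendsto_id) (by simp)
      ).eventually_const_lt h
  obtain ⟨a, b, hb, hab, hp⟩ := exists_nat_div_of_eventually ht hc
  have hb0 : (b : ℝ≥0∞) ≠ 0 := by simpa using hb.ne'
  have hlt : p * b + 1 ≤ q * (n * b + a) := by
    have h1 := ENNReal.mul_lt_mul_left hb0 (by simp) hp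
    have h2 : (q * (n + a / b) : ℝ≥0∞) * b = q * (n * b + a) := by
      rw [mul_assoc, add_mul, ENNReal.div_mul_cancel hb0 (by simp)]
    rw [h2] at h1
    exact_mod_cast h1
  -- Expanding `a / b` by `p + 1` makes the slack of one in `hlt` exceed the extra summand `p`.
  refine ⟨(p + 1) * a, (p + 1) * b, ?_, ?_⟩
  · have := ENNReal.mul_lt_mul_right (a := (p + 1 : ℕ)) (by simp) (ENNReal.natCast_ne_top _) hab
    rw [← mul_assoc] at this
    exact_mod_cast this
  · have := Nat.mul_le_mul_left (p + 1) hlt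
    nlinarith [Nat.zero_le (q * n)]

/-- If `p / q < s + t`, there are fractions `r₁ / k < s` and `r₂ / k < t` with
`p / q < (r₁ + r₂) / (k + 1)`. -/
theorem exists_nat_mul_lt_add {s t : ℝ≥0∞} {p q : ℕ} (h : (p : ℝ≥0∞) < q * (s + t)) (hs : s ≠ 0)
    (ht : t ≠ 0) : ∃ r₁ r₂ k : ℕ, (r₁ : ℝ≥0∞) < k * s ∧ (r₂ : ℝ≥0∞) < k * t ∧
      p * (k + 1) < q * (r₁ + r₂) := by
  have hc : ∀ᶠ u in 𝓝 s, (p : ℝ≥0∞) < q * (u + t) :=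
    (ENNReal.Tendsto.const_mul (Filter.tendsto_id.add tendsto_const_nhds) (by simp)
      ).eventually_const_lt h
  obtain ⟨a, b, hb, hab, hp⟩ := exists_nat_div_of_eventually hs hc
  have hb0 : (b : ℝ≥0∞) ≠ 0 := by simpa using hb.ne'
  have hc : ∀ᶠ u in 𝓝 t, (p : ℝ≥0∞) < q * (a / b + u) :=
    (ENNReal.Tendsto.const_mul (tendsto_const_nhds.add Filter.tendsto_id) (by simp)
      ).eventually_const_lt hp
  obtain ⟨c, d, hd, hcd, hp⟩ := exists_nat_div_of_eventually ht hc
  have hd0 : (d : ℝ≥0∞) ≠ 0 := by simpa using hd.ne'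
  have hlt : p * (b * d) + 1 ≤ q * (a * d + c * b) := by
    have h1 := ENNReal.mul_lt_mul_left (mul_ne_zero hb0 hd0)
      (ENNReal.mul_ne_top (by simp) (by simp)) hp
    have h2 : (q * (a / b + c / d) : ℝ≥0∞) * (b * d) =
        q * ((a / b * b) * d + (c / d * d) * b) := by ring
    rw [h2, ENNReal.div_mul_cancel hb0 (by simp), ENNReal.div_mul_cancel hd0 (by simp)] at h1
    exact_mod_cast h1
  -- The common denominator `b d` is expanded by `p + 1` to absorb the extra summand `p`.
  refine ⟨(p + 1) * d * a, (p + 1) * b * c, (p + 1) * b * d, ?_, ?_, ?_⟩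
  · have := ENNReal.mul_lt_mul_right (a := ((p + 1) * d : ℕ)) (by simp [hd.ne'])
      (ENNReal.natCast_ne_top _) hab
    push_cast at this ⊢
    convert this using 1
    ring
  · have := ENNReal.mul_lt_mul_right (a := ((p + 1) * b : ℕ)) (by simp [hb.ne'])
      (ENNReal.natCast_ne_top _) hcd
    push_cast at this ⊢
    convert this using 1
    ring
  · have := Nat.mul_le_mul_left (p + 1) hlt
    nlinarith

/-- If `p / q < s t`, there is a fraction `r / k < s` with `p / q < (r / k) t`. -/
theorem exists_nat_mul_lt_mul {s t : ℝ≥0∞} {p q : ℕ} (h : (p : ℝ≥0∞) < q * (s * t)) (hs : s ≠ 0) :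
    ∃ r k : ℕ, (r : ℝ≥0∞) < k * s ∧ ((p * k : ℕ) : ℝ≥0∞) < q * (r * t) := by
  have hc : ∀ᶠ u in 𝓝 s, (p : ℝ≥0∞) < q * (u * t) :=
    (ENNReal.Tendsto.const_mul (ENNReal.Tendsto.mul_const Filter.tendsto_id (.inl hs))
      (by simp)).eventually_const_lt
      h
  obtain ⟨a, b, hb, hab, hp⟩ := exists_nat_div_of_eventually hs hc
  have hb0 : (b : ℝ≥0∞) ≠ 0 := by simpa using hb.ne'
  refine ⟨a, b, hab, ?_⟩
  have h1 := ENNReal.mul_lt_mul_left hb0 (by simp) hp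
  have h2 : (q * (a / b * t) : ℝ≥0∞) * b = q * ((a / b * b) * t) := by ring
  rw [h2, ENNReal.div_mul_cancel hb0 (by simp)] at h1
  exact_mod_cast h1

/-! ### Multiplication by soft elements -/

section SoftMul

variable {S : Type*} [AddCommMonoid S] [PartialOrder S]

/-- The elements `x` that will be compactly contained in the product of the soft element `t` and
`a`: those with `q x ≪ p a` for some fraction `p / q < t`. -/
def SoftBelow (t : ℝ≥0∞) (a x : S) : Prop :=
  ∃ p q : ℕ, (p : ℝ≥0∞) < q * t ∧ WayBelow (q • x) (p • a)

theorem natCast_mul_lt_of_lt {t : ℝ≥0∞} {p q n : ℕ} (hn : n ≠ 0) (h : (p : ℝ≥0∞) < q * t) :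
    ((n * p : ℕ) : ℝ≥0∞) < (n * q : ℕ) * t := by
  have := ENNReal.mul_lt_mul_right (a := (n : ℕ)) (by simpa using hn) (ENNReal.natCast_ne_top _) h
  rw [← mul_assoc] at this
  exact_mod_cast this

theorem ne_zero_of_natCast_lt_mul {t : ℝ≥0∞} {p q : ℕ} (h : (p : ℝ≥0∞) < q * t) : q ≠ 0 := by
  rintro rfl
  simp at h

variable [CuSemigroup S]

theorem SoftBelow.of_le {t : ℝ≥0∞} {a x y : S} (hxy : x ≤ y) (h : SoftBelow t a y) :
    SoftBelow t a x := by
  obtain ⟨p, q, hpq, h⟩ := h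
  exact ⟨p, q, hpq, h.le_trans (nsmul_le_nsmul_right hxy q)⟩

/-- Two fractions can be given a common denominator. -/
theorem SoftBelow.exists_common {s t : ℝ≥0∞} {a b x y : S} (hx : SoftBelow s a x)
    (hy : SoftBelow t b y) : ∃ p p' q : ℕ, (p : ℝ≥0∞) < q * s ∧ (p' : ℝ≥0∞) < q * t ∧
      WayBelow (q • x) (p • a) ∧ WayBelow (q • y) (p' • b) := by
  obtain ⟨p, q, hpq, hx⟩ := hx
  obtain ⟨p', q', hpq', hy⟩ := hy
  refine ⟨q' * p, q * p', q' * q, natCast_mul_lt_of_lt (ne_zero_of_natCast_lt_mul hpq') hpq,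
    mul_comm q' q ▸ natCast_mul_lt_of_lt (ne_zero_of_natCast_lt_mul hpq) hpq', ?_, ?_⟩
  · simpa only [mul_nsmul'] using hx.nsmul q'
  · rw [mul_comm q' q]
    simpa only [mul_nsmul'] using hy.nsmul q

/-- The elements `y` with `k y ≪ r a` and `r a' ≤ (k + 1) y`, for fractions `r / k < t` and
`a' ≪ a`, are cofinal among the `x` with `SoftBelow t a x`; this makes these `x` an ideal with a
countable cofinal subset, whose supremum is the product. -/
theorem exists_wayBelow_iff_softBelow (hU : AlmostUnperforated S) (hD : AlmostDivisible S)
    {t : ℝ≥0∞} (ht : t ≠ 0) (a : S) : ∃ m : S, ∀ x, WayBelow x m ↔ SoftBelow t a x := by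
  obtain ⟨u, hu, -, hua, hux⟩ := exists_rapid_seq a
  let ι := {i : ℕ × ℕ × ℕ // (i.1 : ℝ≥0∞) < i.2.1 * t}
  have hy : ∀ i : ι, ∃ y, WayBelow (i.1.2.1 • y) (i.1.1 • a) ∧
      i.1.1 • u i.1.2.2 ≤ (i.1.2.1 + 1) • y := fun i =>
    hD.exists_wayBelow (hua _) (Nat.one_le_iff_ne_zero.2 (ne_zero_of_natCast_lt_mul i.2)) _
  choose y hya hay using hy
  have hyt : ∀ i, SoftBelow t a (y i) := fun i => ⟨_, _, i.2, hya i⟩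
  -- The family dominates every `x` with `q x ≪ p (u n)`; the index carries the same `n`.
  have hcof : ∀ p q n : ℕ, (p : ℝ≥0∞) < q * t → ∃ i, ∀ x, WayBelow (q • x) (p • u n) →
      WayBelow x (y i) := by
    intro p q n hpq
    obtain ⟨r, k, hrk, hlt⟩ := exists_nat_mul_lt (n := 0) (by simpa using hpq) ht
    exact ⟨⟨(r, k, n), hrk⟩, fun x hx =>
      hU.wayBelow_of_nsmul_le (by simpa using hlt) hx (hay ⟨(r, k, n), hrk⟩)⟩
  have hlevel : ∀ (x : S) (p : ℕ), WayBelow x (p • a) → ∃ n, ∀ m, n ≤ m → WayBelow x (p • u m) := by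
    intro x p hx
    obtain ⟨c, hca, hxc⟩ := hx.exists_nsmul
    obtain ⟨n, hn⟩ := hux c hca
    exact ⟨n, fun m hm => hxc.trans_le (nsmul_le_nsmul_right (hn.le.trans (hu hm)) p)⟩
  -- Two members of the family are compared with the multiple of `a` having the larger numerator.
  have hdir : Directed (· ≤ ·) y := by
    intro i j
    obtain ⟨p, p', q, hp, hp', hi, hj⟩ := (hyt i).exists_common (hyt j)
    have hmax : ((max p p' : ℕ) : ℝ≥0∞) < q * t := by
      rcases max_choice p p' with h | h <;> rw [h] <;> assumption
    have hz := CuSemigroup.zero_le' a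
    obtain ⟨n, hn⟩ := hlevel _ _ (hi.trans_le (nsmul_le_nsmul_left hz (le_max_left p p')))
    obtain ⟨n', hn'⟩ := hlevel _ _ (hj.trans_le (nsmul_le_nsmul_left hz (le_max_right p p')))
    obtain ⟨l, hl⟩ := hcof _ _ (max n n') hmax
    exact ⟨l, (hl _ (hn _ (le_max_left _ _))).le, (hl _ (hn' _ (le_max_right _ _))).le⟩
  have : Encodable ι := Encodable.ofCountable ι
  have : Inhabited ι := ⟨⟨(0, 1, 0), by simpa using pos_iff_ne_zero.2 ht⟩⟩
  obtain ⟨m, hm⟩ := CuSemigroup.exists_sup _ hdir.sequence_mono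
  refine ⟨m, fun x => ⟨fun hx => ?_, ?_⟩⟩
  · obtain ⟨k, hk⟩ := hx _ _ hdir.sequence_mono hm le_rfl
    exact (hyt _).of_le hk
  · rintro ⟨p, q, hpq, hx⟩
    obtain ⟨n, hn⟩ := hlevel _ _ hx
    obtain ⟨i, hi⟩ := hcof _ _ n hpq
    exact (hi _ (hn n le_rfl)).trans_le ((hdir.le_sequence i).trans (hm.1 ⟨_, rfl⟩))

/-- The product of the soft element `t` and `a`, characterized by `wayBelow_softMul`; it is a junk
value when no element has the required property. -/
noncomputable def softMul (t : ℝ≥0∞) (a : S) : S :=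
  Classical.epsilon fun m => ∀ x, WayBelow x m ↔ SoftBelow t a x

theorem wayBelow_softMul (hU : AlmostUnperforated S) (hD : AlmostDivisible S) {t : ℝ≥0∞}
    (ht : t ≠ 0) {a x : S} : WayBelow x (softMul t a) ↔ SoftBelow t a x :=
  Classical.epsilon_spec (exists_wayBelow_iff_softBelow hU hD ht a) x

/-- The action of `Z`: compact elements act by multiples, soft elements by `softMul`. -/
noncomputable def jiangSuMul : JiangSu → S → S
  | .compact n, a => n • a
  | .soft t _, a => softMul t a

theorem wayBelow_jiangSuMul_soft (hU : AlmostUnperforated S) (hD : AlmostDivisible S) {t : ℝ≥0∞}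
    (ht : t ≠ 0) {a x : S} : WayBelow x (jiangSuMul (.soft t ht) a) ↔ SoftBelow t a x :=
  wayBelow_softMul hU hD ht

/-- For `n` compact, `q x ≪ p a` and `p / q < n` imply `x ≪ n a` by almost unperforation, so that
compact and soft elements can be treated alike. -/
theorem SoftBelow.wayBelow (hU : AlmostUnperforated S) (hD : AlmostDivisible S) {z : JiangSu}
    {a x : S} (h : SoftBelow z.val a x) : WayBelow x (jiangSuMul z a) := by
  rcases z with n | ⟨t, ht⟩
  · obtain ⟨p, q, hpq, hx⟩ := h
    have hpq : p < q * n := by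
      rw [JiangSu.val] at hpq
      exact_mod_cast hpq
    refine hU.wayBelow (m := n * q) (n := p) (by rwa [mul_comm]) ?_
    change WayBelow _ (p • n • a)
    rw [← mul_nsmul', mul_comm p n, mul_nsmul', mul_nsmul']
    exact hx.nsmul n
  · exact (wayBelow_jiangSuMul_soft hU hD ht).2 h

/-- Only `≤` holds in general, as `n` itself is the best fraction for a compact element `n`. -/
theorem WayBelow.exists_of_jiangSuMul (hU : AlmostUnperforated S) (hD : AlmostDivisible S)
    {z : JiangSu} {a x : S} (h : WayBelow x (jiangSuMul z a)) :
    ∃ p q : ℕ, q ≠ 0 ∧ (p : ℝ≥0∞) ≤ q * z.val ∧ WayBelow (q • x) (p • a) := by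
  rcases z with n | ⟨t, ht⟩
  · exact ⟨n, 1, one_ne_zero, by simp [JiangSu.val], by rw [one_nsmul]; exact h⟩
  · obtain ⟨p, q, hpq, hx⟩ := (wayBelow_jiangSuMul_soft hU hD ht).1 h
    exact ⟨p, q, ne_zero_of_natCast_lt_mul hpq, hpq.le, hx⟩

/-! ### The axioms of a `Z`-multiplication -/

/-- Almost divisibility yields approximations of `(r / k) a'` below `t a`. -/
theorem exists_wayBelow_jiangSuMul_soft (hU : AlmostUnperforated S) (hD : AlmostDivisible S)
    {t : ℝ≥0∞} (ht : t ≠ 0) {a' a : S} (ha : WayBelow a' a) {r k : ℕ} (h : (r : ℝ≥0∞) < k * t) :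
    ∃ y, WayBelow y (jiangSuMul (.soft t ht) a) ∧ r • a' ≤ (k + 1) • y := by
  obtain ⟨y, hy, hay⟩ :=
    hD.exists_wayBelow ha (Nat.one_le_iff_ne_zero.2 (ne_zero_of_natCast_lt_mul h)) r
  exact ⟨y, (wayBelow_jiangSuMul_soft hU hD ht).2 ⟨r, k, h, hy⟩, hay⟩

theorem jiangSuMul_mono_right (hU : AlmostUnperforated S) (hD : AlmostDivisible S) (z : JiangSu)
    {a b : S} (h : a ≤ b) : jiangSuMul z a ≤ jiangSuMul z b := by
  rcases z with n | ⟨t, ht⟩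
  · exact nsmul_le_nsmul_right h n
  · refine le_of_forall_wayBelow fun x hx => ?_
    obtain ⟨p, q, hpq, hx⟩ := (wayBelow_jiangSuMul_soft hU hD ht).1 hx
    exact ((wayBelow_jiangSuMul_soft hU hD ht).2
      ⟨p, q, hpq, hx.trans_le (nsmul_le_nsmul_right h p)⟩).le

theorem jiangSuMul_mono_left (hU : AlmostUnperforated S) (hD : AlmostDivisible S) {z w : JiangSu}
    (h : z ≤ w) (a : S) : jiangSuMul z a ≤ jiangSuMul w a := by
  rcases z with m | ⟨s, hs⟩
  · rcases w with n | ⟨t, ht⟩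
    · exact nsmul_le_nsmul_left (CuSemigroup.zero_le' a) h
    · have h : (m : ℝ≥0∞) < t := h
      exact le_of_forall_wayBelow fun x hx => (SoftBelow.wayBelow hU hD (z := .soft t ht)
        ⟨m, 1, by simpa [JiangSu.val] using h, by rw [one_nsmul]; exact hx⟩).le
  · refine le_of_forall_wayBelow fun x hx => (SoftBelow.wayBelow hU hD ?_).le
    obtain ⟨p, q, hpq, hx⟩ := (wayBelow_jiangSuMul_soft hU hD hs).1 hx
    exact ⟨p, q, hpq.trans_le (mul_le_mul_right (JiangSu.val_mono h) _), hx⟩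

theorem jiangSuMul_add_right (hU : AlmostUnperforated S) (hD : AlmostDivisible S) (z : JiangSu)
    (a b : S) : jiangSuMul z (a + b) = jiangSuMul z a + jiangSuMul z b := by
  rcases z with n | ⟨t, ht⟩
  · exact nsmul_add a b n
  refine le_antisymm (le_of_forall_wayBelow fun x hx => ?_)
    (add_le_of_forall_wayBelow fun x y hx hy => ?_)
  · obtain ⟨p, q, hpq, hx⟩ := (wayBelow_jiangSuMul_soft hU hD ht).1 hx
    obtain ⟨c, hc, hxc⟩ := hx.exists_nsmul
    obtain ⟨a', b', ha, hb, hcab⟩ := hc.exists_add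
    obtain ⟨r, k, hrk, hlt⟩ := exists_nat_mul_lt (n := 0) (by simpa using hpq) ht
    obtain ⟨y, hy, hay⟩ := exists_wayBelow_jiangSuMul_soft hU hD ht ha hrk
    obtain ⟨y', hy', hby⟩ := exists_wayBelow_jiangSuMul_soft hU hD ht hb hrk
    refine (hU.wayBelow_of_nsmul_le (by simpa using hlt)
      (hxc.trans_le (nsmul_le_nsmul_right hcab p)) ?_).le.trans (add_le_add hy.le hy'.le)
    rw [nsmul_add, nsmul_add]
    exact add_le_add hay hby
  · rw [wayBelow_jiangSuMul_soft hU hD ht] at hx hy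
    obtain ⟨p, p', q, hp, hp', hx, hy⟩ := hx.exists_common hy
    -- The same fraction serves both summands once the numerators are replaced by their maximum.
    refine ((wayBelow_jiangSuMul_soft hU hD ht).2 ⟨max p p', q, ?_, ?_⟩).le
    · rcases max_choice p p' with h | h <;> rw [h] <;> assumption
    · rw [nsmul_add, nsmul_add]
      exact (hx.trans_le (nsmul_le_nsmul_left (CuSemigroup.zero_le' a) (le_max_left _ _))).add
        (hy.trans_le (nsmul_le_nsmul_left (CuSemigroup.zero_le' b) (le_max_right _ _)))

theorem jiangSuMul_compact_add_soft (hU : AlmostUnperforated S) (hD : AlmostDivisible S) (n : ℕ)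
    {t : ℝ≥0∞} (ht : t ≠ 0) (a : S) : jiangSuMul (.compact n + .soft t ht) a =
      jiangSuMul (.compact n) a + jiangSuMul (.soft t ht) a := by
  have ht' : (n + t : ℝ≥0∞) ≠ 0 := by simp [ht]
  change jiangSuMul (.soft (n + t) ht') a = n • a + jiangSuMul (.soft t ht) a
  refine le_antisymm (le_of_forall_wayBelow fun x hx => ?_)
    (add_le_of_forall_wayBelow fun x y hx hy => ?_)
  · obtain ⟨p, q, hpq, hx⟩ := (wayBelow_jiangSuMul_soft hU hD ht').1 hx
    obtain ⟨a', ha, hxa⟩ := hx.exists_nsmul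
    obtain ⟨r, k, hrk, hlt⟩ := exists_nat_mul_lt hpq ht
    obtain ⟨y, hy, hay⟩ := exists_wayBelow_jiangSuMul_soft hU hD ht ha hrk
    refine (hU.wayBelow_of_nsmul_le (y := n • a' + y) hlt hxa ?_).le.trans
      (add_le_add (nsmul_le_nsmul_right ha.le n) hy.le)
    rw [nsmul_add, add_nsmul, mul_comm, mul_nsmul']
    exact add_le_add le_rfl hay
  · obtain ⟨p, q, hpq, hy⟩ := (wayBelow_jiangSuMul_soft hU hD ht).1 hy
    refine ((wayBelow_jiangSuMul_soft hU hD ht').2 ⟨q * n + p, q, ?_, ?_⟩).le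
    · rw [mul_add]
      push_cast
      exact ENNReal.add_lt_add_left (ENNReal.mul_ne_top (by simp) (by simp)) hpq
    · rw [nsmul_add, add_nsmul, mul_nsmul']
      exact (hx.nsmul q).add hy

theorem jiangSuMul_soft_add_soft (hU : AlmostUnperforated S) (hD : AlmostDivisible S)
    {s t : ℝ≥0∞} (hs : s ≠ 0) (ht : t ≠ 0) (a : S) : jiangSuMul (.soft s hs + .soft t ht) a =
      jiangSuMul (.soft s hs) a + jiangSuMul (.soft t ht) a := by
  have ht' : s + t ≠ 0 := by simp [ht]
  change jiangSuMul (.soft (s + t) ht') a = _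
  refine le_antisymm (le_of_forall_wayBelow fun x hx => ?_)
    (add_le_of_forall_wayBelow fun x y hx hy => ?_)
  · obtain ⟨p, q, hpq, hx⟩ := (wayBelow_jiangSuMul_soft hU hD ht').1 hx
    obtain ⟨a', ha, hxa⟩ := hx.exists_nsmul
    obtain ⟨r, r', k, hrk, hrk', hlt⟩ := exists_nat_mul_lt_add hpq hs ht
    obtain ⟨y, hy, hay⟩ := exists_wayBelow_jiangSuMul_soft hU hD hs ha hrk
    obtain ⟨y', hy', hay'⟩ := exists_wayBelow_jiangSuMul_soft hU hD ht ha hrk'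
    refine (hU.wayBelow_of_nsmul_le (y := y + y') hlt hxa ?_).le.trans (add_le_add hy.le hy'.le)
    rw [nsmul_add, add_nsmul]
    exact add_le_add hay hay'
  · rw [wayBelow_jiangSuMul_soft hU hD] at hx hy
    obtain ⟨p, p', q, hp, hp', hx, hy⟩ := hx.exists_common hy
    refine ((wayBelow_jiangSuMul_soft hU hD ht').2 ⟨p + p', q, ?_, ?_⟩).le
    · rw [mul_add]
      push_cast
      exact ENNReal.add_lt_add hp hp'
    · rw [nsmul_add, add_nsmul]
      exact hx.add hy

theorem jiangSuMul_add_left (hU : AlmostUnperforated S) (hD : AlmostDivisible S) (z w : JiangSu)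
    (a : S) : jiangSuMul (z + w) a = jiangSuMul z a + jiangSuMul w a := by
  rcases z with m | ⟨s, hs⟩ <;> rcases w with n | ⟨t, ht⟩
  · exact add_nsmul a m n
  · exact jiangSuMul_compact_add_soft hU hD m ht a
  · rw [add_comm, jiangSuMul_compact_add_soft hU hD n hs a, add_comm]
  · exact jiangSuMul_soft_add_soft hU hD hs ht a

theorem jiangSuMul_nsmul_left (hU : AlmostUnperforated S) (hD : AlmostDivisible S) (n : ℕ)
    (z : JiangSu) (a : S) : jiangSuMul (n • z) a = n • jiangSuMul z a := by
  induction n with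
  | zero => rw [zero_nsmul, zero_nsmul]; exact zero_nsmul a
  | succ n ih => rw [succ_nsmul, succ_nsmul, jiangSuMul_add_left hU hD, ih]

theorem jiangSuMul_zero_right (hU : AlmostUnperforated S) (hD : AlmostDivisible S) (z : JiangSu) :
    jiangSuMul z (0 : S) = 0 := by
  refine le_antisymm (le_of_forall_wayBelow fun x hx => ?_) (CuSemigroup.zero_le' _)
  obtain ⟨p, q, hq, -, hx⟩ := hx.exists_of_jiangSuMul hU hD
  rw [nsmul_zero] at hx
  simpa using (nsmul_le_nsmul_left (CuSemigroup.zero_le' x)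
    (Nat.one_le_iff_ne_zero.2 hq)).trans hx.le

theorem jiangSuMul_nsmul_right (hU : AlmostUnperforated S) (hD : AlmostDivisible S) (n : ℕ)
    (z : JiangSu) (a : S) : jiangSuMul z (n • a) = n • jiangSuMul z a := by
  induction n with
  | zero => rw [zero_nsmul, zero_nsmul]; exact jiangSuMul_zero_right hU hD z
  | succ n ih => rw [succ_nsmul, succ_nsmul, jiangSuMul_add_right hU hD, ih]

theorem JiangSu.compact_mul (n : ℕ) (z : JiangSu) : compact n * z = n • z := by
  induction n with
  | zero => rw [zero_nsmul]; exact zero_mul z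
  | succ n ih => rw [succ_nsmul, ← ih]; exact (add_mul (compact n) 1 z).trans (by rw [one_mul])

theorem JiangSu.val_nsmul (n : ℕ) (z : JiangSu) : (n • z).val = n * z.val := by
  rw [← compact_mul, val_mul]
  rfl

theorem jiangSuMul_mul (hU : AlmostUnperforated S) (hD : AlmostDivisible S) (z w : JiangSu)
    (a : S) : jiangSuMul (z * w) a = jiangSuMul z (jiangSuMul w a) := by
  rcases z with m | ⟨s, hs⟩
  · rw [JiangSu.compact_mul, jiangSuMul_nsmul_left hU hD]
    rfl
  rcases w with n | ⟨t, ht⟩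
  · rw [mul_comm, JiangSu.compact_mul, jiangSuMul_nsmul_left hU hD]
    exact (jiangSuMul_nsmul_right hU hD n _ a).symm
  have hst : s * t ≠ 0 := mul_ne_zero hs ht
  change jiangSuMul (.soft (s * t) hst) a = _
  refine le_antisymm (le_of_forall_wayBelow fun x hx => ?_) (le_of_forall_wayBelow fun x hx => ?_)
  · obtain ⟨p, q, hpq, hx⟩ := (wayBelow_jiangSuMul_soft hU hD hst).1 hx
    obtain ⟨r, k, hrk, hlt⟩ := exists_nat_mul_lt_mul hpq hs
    -- It remains to see `k x ≪ r (t a) = (r t) a`, which the fraction `p k / q < r t` witnesses.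
    refine ((wayBelow_jiangSuMul_soft hU hD hs).2 ⟨r, k, hrk, ?_⟩).le
    rw [← jiangSuMul_nsmul_left hU hD]
    refine SoftBelow.wayBelow hU hD ⟨p * k, q, by rwa [JiangSu.val_nsmul], ?_⟩
    rw [← mul_nsmul', mul_comm q, mul_comm p, mul_nsmul', mul_nsmul']
    exact hx.nsmul k
  · obtain ⟨p, q, hpq, hx⟩ := (wayBelow_jiangSuMul_soft hU hD hs).1 hx
    rw [← jiangSuMul_nsmul_left hU hD] at hx
    obtain ⟨p', q', hq', hpq', hx⟩ := hx.exists_of_jiangSuMul hU hD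
    refine ((wayBelow_jiangSuMul_soft hU hD hst).2 ⟨p', q' * q, ?_, ?_⟩).le
    · rw [JiangSu.val_nsmul] at hpq'
      change (p' : ℝ≥0∞) ≤ q' * (p * t) at hpq'
      -- For `t = ∞` multiplication by `t` does not preserve strict inequalities.
      rcases eq_or_ne t ⊤ with rfl | htt
      · have := ne_zero_of_natCast_lt_mul hpq
        rw [ENNReal.mul_top hs, ENNReal.mul_top (by simp [hq', this])]
        exact ENNReal.natCast_lt_top _
      · refine hpq'.trans_lt ?_
        have := ENNReal.mul_lt_mul_right (a := q') (by simpa using hq') (by simp)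
          (ENNReal.mul_lt_mul_left ht htt hpq)
        simpa [mul_assoc] using this
    · rwa [mul_nsmul']

theorem jiangSuMul_map_wayBelow (hU : AlmostUnperforated S) (hD : AlmostDivisible S)
    {z' z : JiangSu} {a' a : S} (hz : WayBelow z' z) (ha : WayBelow a' a) :
    WayBelow (jiangSuMul z' a') (jiangSuMul z a) := by
  rcases z with n | ⟨t, ht⟩
  · exact (ha.nsmul n).le_trans (jiangSuMul_mono_left hU hD hz.le a')
  · have hlt : z'.val < t := (JiangSu.wayBelow_iff.1 hz).2 trivial
    obtain ⟨p, q, hq, hpq, hz'⟩ := exists_nat_div_of_eventually ht (lt_mem_nhds hlt)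
    -- A fraction with `z' < p / q < t` gives `q (z' a') = (q z') a' ≤ p a' ≪ p a`.
    refine (wayBelow_jiangSuMul_soft hU hD ht).2 ⟨p, q, hpq, (ha.nsmul p).le_trans ?_⟩
    rw [← jiangSuMul_nsmul_left hU hD]
    refine jiangSuMul_mono_left hU hD (w := .compact p) (JiangSu.le_of_val_lt ?_) a'
    rw [JiangSu.val_nsmul, mul_comm]
    exact (ENNReal.lt_div_iff_mul_lt (by simp [hq.ne']) (by simp)).1 hz'

theorem jiangSuMul_map_sup (hU : AlmostUnperforated S) (hD : AlmostDivisible S) {z : ℕ → JiangSu}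
    {a : ℕ → S} {w : JiangSu} {b : S} (hz : Monotone z) (ha : Monotone a)
    (hw : IsLUB (Set.range z) w) (hb : IsLUB (Set.range a) b) :
    IsLUB (Set.range fun n => jiangSuMul (z n) (a n)) (jiangSuMul w b) := by
  constructor
  · rintro _ ⟨n, rfl⟩
    exact (jiangSuMul_mono_left hU hD (hw.1 ⟨n, rfl⟩) _).trans
      (jiangSuMul_mono_right hU hD _ (hb.1 ⟨n, rfl⟩))
  intro c hc
  have hc : ∀ n, jiangSuMul (z n) (a n) ≤ c := fun n => hc ⟨n, rfl⟩
  rcases w with m | ⟨t, ht⟩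
  · obtain ⟨n, hn⟩ | ⟨h, -⟩ := (JiangSu.isLUB_iff hz).1 hw
    · refine (isLUB_nsmul ha hb m).2 ?_
      rintro _ ⟨k, rfl⟩
      have := hc (max n k)
      rw [hn _ (le_max_left _ _)] at this
      exact (nsmul_le_nsmul_right (ha (le_max_right n k)) m).trans this
    · exact h.elim
  · refine le_of_forall_wayBelow fun x hx => ?_
    obtain ⟨p, q, hpq, hx⟩ := (wayBelow_jiangSuMul_soft hU hD ht).1 hx
    have hv : (p : ℝ≥0∞) < ⨆ n, q * (z n).val := by
      rw [← ENNReal.mul_iSup, ← JiangSu.val_isLUB hz hw]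
      exact hpq
    obtain ⟨n, hn⟩ := lt_iSup_iff.1 hv
    obtain ⟨b', hb', hxb⟩ := hx.exists_nsmul
    obtain ⟨k, hk⟩ := hb' a b ha hb le_rfl
    refine (SoftBelow.wayBelow hU hD (z := z (max n k)) (a := a (max n k)) ⟨p, q, ?_, ?_⟩).le.trans
      (hc (max n k))
    · exact hn.trans_le (mul_le_mul_right (JiangSu.val_mono (hz (le_max_left n k))) _)
    · exact hxb.trans_le (nsmul_le_nsmul_right (hk.trans (ha (le_max_right n k))) p)

/-- Almost unperforated and almost divisible Cu-semigroups have `Z`-multiplication. -/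
theorem hasMultiplication_jiangSu (hU : AlmostUnperforated S) (hD : AlmostDivisible S) :
    HasMultiplication JiangSu S :=
  ⟨jiangSuMul,
    { zero_left := zero_nsmul
      zero_right := jiangSuMul_zero_right hU hD
      add_left := jiangSuMul_add_left hU hD
      add_right := jiangSuMul_add_right hU hD
      mono_left := fun _ _ b h => jiangSuMul_mono_left hU hD h b
      mono_right := fun z _ _ h => jiangSuMul_mono_right hU hD z h
      map_sup := fun _ _ _ _ => jiangSuMul_map_sup hU hD
      map_wayBelow := fun _ _ _ _ => jiangSuMul_map_wayBelow hU hD },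
    jiangSuMul_mul hU hD, one_nsmul⟩

end SoftMul

/-! ### Almost unperforation and almost divisibility from a `Z`-action -/

namespace JiangSu

/-- Soft approximants of `1 / k` from below, larger than `1 / (k + 1)`. -/
theorem exists_seq_nsmul_le_one {k : ℕ} (hk : k ≠ 0) : ∃ u : ℕ → JiangSu,
    (∀ n, WayBelow (u n) (u (n + 1))) ∧ (∀ n, k • u n ≤ 1) ∧ ∀ n, 1 ≤ (k + 1) • u n := by
  have hlt : ((k + 1 : ℕ) : ℝ≥0∞)⁻¹ < (k : ℝ≥0∞)⁻¹ := by
    rw [ENNReal.inv_lt_inv]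
    exact_mod_cast k.lt_succ_self
  obtain ⟨u, hu, hu', -⟩ := exists_seq_strictMono_tendsto' hlt
  have h0 : ∀ n, u n ≠ 0 := fun n => (hu' n).1.ne_bot
  refine ⟨fun n => soft (u n) (h0 n), fun n => wayBelow_iff.2 ⟨le_of_val_lt (hu n.lt_succ_self),
    fun _ => hu n.lt_succ_self⟩, fun n => le_of_not_soft not_isSoft_one ?_,
    fun n => le_of_val_lt ?_⟩
  · rw [val_nsmul, val_one]
    refine (mul_le_mul_right (hu' n).2.le _).trans ?_
    rw [ENNReal.mul_inv_cancel (by simpa using hk) (by simp)]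
  · rw [val_nsmul, val_one]
    have := ENNReal.mul_lt_mul_right (a := (k + 1 : ℕ)) (by simp) (by simp) (hu' n).1
    rwa [ENNReal.mul_inv_cancel (by simp) (by simp)] at this

end JiangSu

section Bimorphism

variable {S T R : Type*} [AddCommMonoid S] [PartialOrder S] [AddCommMonoid T] [PartialOrder T]
  [AddCommMonoid R] [PartialOrder R]

theorem IsCuBimorphism.nsmul_left {f : S → T → R} (hf : IsCuBimorphism f) (n : ℕ) (a : S) (b : T) :
    f (n • a) b = n • f a b := by
  induction n with
  | zero => rw [zero_nsmul, zero_nsmul, hf.zero_left]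
  | succ n ih => rw [succ_nsmul, succ_nsmul, hf.add_left, ih]

theorem IsCuBimorphism.nsmul_right {f : S → T → R} (hf : IsCuBimorphism f) (n : ℕ) (a : S) (b : T) :
    f a (n • b) = n • f a b := by
  induction n with
  | zero => rw [zero_nsmul, zero_nsmul, hf.zero_right]
  | succ n ih => rw [succ_nsmul, succ_nsmul, hf.add_right, ih]

end Bimorphism

section Multiplication

variable {S : Type*} [AddCommMonoid S] [PartialOrder S] [CuSemigroup S]

theorem HasMultiplication.almostUnperforated (h : HasMultiplication JiangSu S) :
    AlmostUnperforated S := by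
  obtain ⟨f, hf, -, hone⟩ := h
  rintro a b ⟨k, hab⟩
  rcases eq_or_ne k 0 with rfl | hk
  · exact le_trans (by simpa using hab) (CuSemigroup.zero_le' b)
  obtain ⟨u, -, hu, hu'⟩ := JiangSu.exists_seq_nsmul_le_one hk
  calc a = f 1 a := (hone a).symm
    _ ≤ f ((k + 1) • u 0) a := hf.mono_left _ _ _ (hu' 0)
    _ = f (u 0) ((k + 1) • a) := by rw [hf.nsmul_left, hf.nsmul_right]
    _ ≤ f (u 0) (k • b) := hf.mono_right _ _ _ hab
    _ = f (k • u 0) b := by rw [hf.nsmul_left, hf.nsmul_right]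
    _ ≤ f 1 b := hf.mono_left _ _ _ (hu 0)
    _ = b := hone b

theorem HasMultiplication.almostDivisible (h : HasMultiplication JiangSu S) :
    AlmostDivisible S := by
  obtain ⟨f, hf, -, hone⟩ := h
  intro a k hk a' ha
  obtain ⟨u, -, hu, hu'⟩ := JiangSu.exists_seq_nsmul_le_one (Nat.one_le_iff_ne_zero.1 hk)
  refine ⟨f (u 0) a, ?_, ha.le.trans ?_⟩
  · rw [← hf.nsmul_left]
    exact (hf.mono_left _ _ _ (hu 0)).trans_eq (hone a)
  · rw [← hf.nsmul_left]
    exact (hone a).symm.trans_le (hf.mono_left _ _ _ (hu' 0))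

end Multiplication

/-! ### The action of `Z` on the tensor product `Z ⊗ S` -/

section TensorAction

/-- Multiplication by `z` in the first factor of `Z ⊗ S`. -/
noncomputable def tensorMul {S : Type*} [AddCommMonoid S] (z : JiangSu) :
    JiangSu ⊗[ℕ] S →ₗ[ℕ] JiangSu ⊗[ℕ] S :=
  LinearMap.rTensor S (LinearMap.mulLeft ℕ z)

@[simp] theorem tensorMul_tmul {S : Type*} [AddCommMonoid S] (z w : JiangSu) (s : S) :
    tensorMul z (w ⊗ₜ[ℕ] s) = (z * w) ⊗ₜ[ℕ] s := rfl

theorem tensorMul_one {S : Type*} [AddCommMonoid S] (x : JiangSu ⊗[ℕ] S) : tensorMul 1 x = x := by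
  induction x with
  | zero => simp
  | tmul w s => simp
  | add x y hx hy => rw [map_add, hx, hy]

theorem tensorMul_nsmul {S : Type*} [AddCommMonoid S] (n : ℕ) (z : JiangSu) (x : JiangSu ⊗[ℕ] S) :
    tensorMul (n • z) x = n • tensorMul z x := by
  induction x with
  | zero => simp
  | tmul w s => rw [tensorMul_tmul, tensorMul_tmul, smul_mul_assoc, TensorProduct.smul_tmul']
  | add x y hx hy => rw [map_add, map_add, hx, hy, nsmul_add]

variable {S : Type*} [AddCommMonoid S] [PartialOrder S]

theorem TensorLE.tensorMul_right (z : JiangSu) {x y : JiangSu ⊗[ℕ] S} (h : TensorLE x y) :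
    TensorLE (tensorMul z x) (tensorMul z y) := by
  induction h with
  | refl x => exact .refl _
  | trans _ _ h₁ h₂ => exact h₁.trans h₂
  | add _ _ h₁ h₂ => simpa only [map_add] using h₁.add h₂
  | zero_le x => simpa only [map_zero] using .zero_le _
  | tmul h₁ h₂ => exact .tmul (JiangSu.mul_mono le_rfl h₁) h₂

theorem TensorLE.tensorMul_left {z w : JiangSu} (h : z ≤ w) (x : JiangSu ⊗[ℕ] S) :
    TensorLE (tensorMul z x) (tensorMul w x) := by
  induction x with
  | zero => simpa only [map_zero] using .refl _
  | tmul v s => exact .tmul (JiangSu.mul_mono h le_rfl) le_rfl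
  | add x y hx hy => simpa only [map_add] using hx.add hy

theorem TensorPrec.tensorMul {z w : JiangSu} (h : WayBelow z w) {x y : JiangSu ⊗[ℕ] S}
    (hxy : TensorPrec x y) : TensorPrec (tensorMul z x) (tensorMul w y) := by
  obtain ⟨n, a', a, b', b, ha, hb, h₁, h₂⟩ := hxy
  refine ⟨n, fun i => z * a' i, fun i => w * a i, b', b, fun i =>
    CuSemiring.isCuBimorphism_mul.map_wayBelow _ _ _ _ h (ha i), hb, ?_, ?_⟩
  · simpa only [map_sum, tensorMul_tmul] using h₁.tensorMul_right z
  · simpa only [map_sum, tensorMul_tmul] using h₂.tensorMul_right w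

/-- The tensor product `Z ⊗ S` is almost unperforated. -/
theorem TensorLE.of_nsmul {x y : JiangSu ⊗[ℕ] S} {k : ℕ}
    (h : TensorLE ((k + 1) • x) (k • y)) : TensorLE x y := by
  rcases eq_or_ne k 0 with rfl | hk
  · rw [zero_add, one_nsmul, zero_nsmul] at h
    exact h.trans (.zero_le y)
  obtain ⟨u, -, hu, hu'⟩ := JiangSu.exists_seq_nsmul_le_one hk
  have h₁ := TensorLE.tensorMul_left (hu' 0) x
  have h₂ := h.tensorMul_right (u 0)
  have h₃ := TensorLE.tensorMul_left (hu 0) y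
  rw [tensorMul_one, tensorMul_nsmul] at h₁ h₃
  rw [map_nsmul, map_nsmul] at h₂
  exact h₁.trans (h₂.trans h₃)

end TensorAction

/-! ### Almost unperforation and almost divisibility of the completed tensor product -/

section CuTensor

variable {S T : Type*} [AddCommMonoid S] [PartialOrder S] [AddCommMonoid T] [PartialOrder T]

theorem CuTensor.exists_mk (x : CuTensor S T) : ∃ y, CuTensor.mk y = x :=
  Quotient.exists_rep x

theorem CuTensor.mk_le_mk {x y : TensorSeq S T} : CuTensor.mk x ≤ CuTensor.mk y ↔ x ≤ y :=
  Iff.rfl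

theorem CuTensor.mk_add (x y : TensorSeq S T) :
    CuTensor.mk (x + y) = CuTensor.mk x + CuTensor.mk y := rfl

theorem CuTensor.mk_nsmul (n : ℕ) (x : TensorSeq S T) :
    CuTensor.mk (n • x) = n • CuTensor.mk x := by
  induction n with
  | zero => rw [zero_nsmul, zero_nsmul]; rfl
  | succ n ih => rw [succ_nsmul, succ_nsmul, mk_add, ih]

theorem TensorSeq.seq_nsmul (n : ℕ) (x : TensorSeq S T) (k : ℕ) : (n • x).seq k = n • x.seq k := by
  induction n with
  | zero => rw [zero_nsmul, zero_nsmul]; rfl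
  | succ n ih => rw [succ_nsmul, succ_nsmul, seq_add, ih]

/-- Termwise inequalities between `≺`-increasing sequences suffice. -/
theorem TensorSeq.le_of_forall_tensorLE {x y : TensorSeq S T}
    (h : ∀ k, ∃ n, TensorLE (x.seq k) (y.seq n)) : x ≤ y := by
  intro k
  obtain ⟨n, hn⟩ := h (k + 1)
  exact ⟨n, (x.prec_succ k).trans_le hn⟩

theorem CuTensor.almostUnperforated : AlmostUnperforated (CuTensor JiangSu S) := by
  rintro a b ⟨k, h⟩
  obtain ⟨x, rfl⟩ := a.exists_mk
  obtain ⟨y, rfl⟩ := b.exists_mk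
  rw [← mk_nsmul, ← mk_nsmul, mk_le_mk] at h
  refine mk_le_mk.2 (TensorSeq.le_of_forall_tensorLE fun i => ?_)
  obtain ⟨j, hj⟩ := h i
  rw [TensorSeq.seq_nsmul, TensorSeq.seq_nsmul] at hj
  exact ⟨j, hj.le.of_nsmul⟩

/-- The witness is the sequence `uₙ xₙ`, where `uₙ` increases to the soft element `1 / k`. -/
theorem CuTensor.exists_nsmul_le (a : CuTensor JiangSu S) {k : ℕ} (hk : k ≠ 0) :
    ∃ b, k • b ≤ a ∧ a ≤ (k + 1) • b := by
  obtain ⟨x, rfl⟩ := a.exists_mk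
  obtain ⟨u, hu, huk, huk'⟩ := JiangSu.exists_seq_nsmul_le_one hk
  refine ⟨mk ⟨fun n => tensorMul (u n) (x.seq n), fun n => (x.prec_succ n).tensorMul (hu n)⟩,
    ?_, ?_⟩
  · rw [← mk_nsmul]
    refine mk_le_mk.2 (TensorSeq.le_of_forall_tensorLE fun n => ⟨n, ?_⟩)
    rw [TensorSeq.seq_nsmul, ← tensorMul_nsmul]
    simpa only [tensorMul_one] using TensorLE.tensorMul_left (huk n) (x.seq n)
  · rw [← mk_nsmul]
    refine mk_le_mk.2 (TensorSeq.le_of_forall_tensorLE fun n => ⟨n, ?_⟩)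
    rw [TensorSeq.seq_nsmul, ← tensorMul_nsmul]
    simpa only [tensorMul_one] using TensorLE.tensorMul_left (huk' n) (x.seq n)

end CuTensor

section Transfer

variable {S T : Type*} [AddCommMonoid S] [PartialOrder S] [AddCommMonoid T] [PartialOrder T]

theorem IsCuMorphism.map_nsmul {f : S → T} (hf : IsCuMorphism f) (n : ℕ) (a : S) :
    f (n • a) = n • f a := by
  induction n with
  | zero => rw [zero_nsmul, zero_nsmul, hf.map_zero]
  | succ n ih => rw [succ_nsmul, succ_nsmul, hf.map_add, ih]

theorem CuIsomorphic.almostUnperforated (h : CuIsomorphic S T) (hT : AlmostUnperforated T) :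
    AlmostUnperforated S := by
  obtain ⟨f, g, hf, hg, hgf, -⟩ := h
  rintro a b ⟨k, hab⟩
  have := hT (f a) (f b) ⟨k, by simpa only [hf.map_nsmul] using hf.monotone hab⟩
  simpa only [hgf _] using hg.monotone this

theorem CuIsomorphic.almostDivisible (h : CuIsomorphic S (CuTensor JiangSu T)) :
    AlmostDivisible S := by
  obtain ⟨f, g, hf, hg, hgf, -⟩ := h
  intro a k hk a' ha
  obtain ⟨b, hb, hb'⟩ := (f a).exists_nsmul_le (Nat.one_le_iff_ne_zero.1 hk)
  refine ⟨g b, ?_, ha.le.trans ?_⟩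
  · simpa only [hg.map_nsmul, hgf _] using hg.monotone hb
  · simpa only [hg.map_nsmul, hgf _] using hg.monotone hb'

end Transfer

/-! ### `Z`-multiplication yields an isomorphism with the tensor product -/

section OrderIso

theorem WayBelow.map_orderIso {P Q : Type*} [PartialOrder P] [PartialOrder Q] (e : P ≃o Q)
    {a' a : P} (h : WayBelow a' a) : WayBelow (e a') (e a) := by
  intro c s hc hs has
  obtain ⟨k, hk⟩ := h (fun n => e.symm (c n)) (e.symm s) (e.symm.monotone.comp hc) (by
    have := e.symm.isLUB_image'.2 hs
    rwa [← Set.range_comp] at this) (e.le_symm_apply.2 has)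
  exact ⟨k, e.le_symm_apply.1 hk⟩

variable {S T : Type*} [AddCommMonoid S] [PartialOrder S] [AddCommMonoid T] [PartialOrder T]

theorem IsCuMorphism.of_orderIso (e : S ≃o T) (h0 : e 0 = 0)
    (hadd : ∀ a b, e (a + b) = e a + e b) : IsCuMorphism e where
  map_zero := h0
  map_add := hadd
  monotone := e.monotone
  map_wayBelow _ _ h := h.map_orderIso e
  map_sup a x _ hx := by
    have := e.isLUB_image'.2 hx
    rwa [← Set.range_comp] at this

/-- An additive order isomorphism is an isomorphism in the category Cu, since compact containment
and suprema are order-theoretic. -/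
theorem CuIsomorphic.of_orderIso (e : S ≃o T) (h0 : e 0 = 0)
    (hadd : ∀ a b, e (a + b) = e a + e b) : CuIsomorphic S T :=
  ⟨e, e.symm, .of_orderIso e h0 hadd,
    .of_orderIso e.symm (e.symm_apply_eq.2 h0.symm) fun a b => e.symm_apply_eq.2 (by simp [hadd]),
    e.symm_apply_apply, e.apply_symm_apply⟩

end OrderIso

section Lift

variable {S T R : Type*} [AddCommMonoid S] [PartialOrder S] [AddCommMonoid T] [PartialOrder T]
  [AddCommMonoid R] [PartialOrder R]

/-- The additive map on the algebraic tensor product induced by a Cu-bimorphism. -/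
noncomputable def IsCuBimorphism.lift {f : S → T → R} (hf : IsCuBimorphism f) :
    S ⊗[ℕ] T →ₗ[ℕ] R :=
  TensorProduct.lift (LinearMap.mk₂ ℕ f hf.add_left hf.nsmul_left hf.add_right
    fun n a b => hf.nsmul_right n a b)

@[simp] theorem IsCuBimorphism.lift_tmul {f : S → T → R} (hf : IsCuBimorphism f) (a : S) (b : T) :
    hf.lift (a ⊗ₜ b) = f a b := rfl

variable [CuSemigroup R]

theorem TensorLE.lift {f : S → T → R} (hf : IsCuBimorphism f) {x y : S ⊗[ℕ] T}
    (h : TensorLE x y) : hf.lift x ≤ hf.lift y := by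
  induction h with
  | refl x => exact le_rfl
  | trans _ _ h₁ h₂ => exact h₁.trans h₂
  | add _ _ h₁ h₂ => simpa only [map_add] using add_le_add h₁ h₂
  | zero_le x => simpa only [map_zero] using CuSemigroup.zero_le' _
  | tmul h₁ h₂ => exact (hf.mono_left _ _ _ h₁).trans (hf.mono_right _ _ _ h₂)

theorem WayBelow.sum {ι : Type*} {s : Finset ι} {a b : ι → R} (h : ∀ i, WayBelow (a i) (b i)) :
    WayBelow (∑ i ∈ s, a i) (∑ i ∈ s, b i) := by
  classical
  induction s using Finset.induction_on with
  | empty => simpa using wayBelow_zero_left _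
  | insert i s hi ih =>
    rw [Finset.sum_insert hi, Finset.sum_insert hi]
    exact (h i).add ih

theorem TensorPrec.lift {f : S → T → R} (hf : IsCuBimorphism f) {x y : S ⊗[ℕ] T}
    (h : TensorPrec x y) : WayBelow (hf.lift x) (hf.lift y) := by
  obtain ⟨n, a', a, b', b, ha, hb, h₁, h₂⟩ := h
  have h₁ := h₁.lift hf
  have h₂ := h₂.lift hf
  simp only [map_sum, hf.lift_tmul] at h₁ h₂
  exact ((WayBelow.sum fun i => hf.map_wayBelow _ _ _ _ (ha i) (hb i)).le_trans h₁).trans_le h₂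

end Lift

/-- Between `z.val < w.val` there is room for a compact `p` with `(k + 1) z ≤ p ≤ k w`. -/
theorem JiangSu.exists_nsmul_le_compact {z w : JiangSu} (h : z.val < w.val) :
    ∃ k p : ℕ, (k + 1) • z ≤ compact p ∧ compact p ≤ k • w := by
  obtain ⟨c, d, hd, hcd, hz⟩ := exists_nat_div_of_eventually h.ne_bot (lt_mem_nhds h)
  obtain ⟨p, k, hp, hlt⟩ := exists_nat_mul_lt (n := 0) (by simpa using hcd) h.ne_bot
  refine ⟨k, p, le_of_not_soft id ?_, le_of_val_lt ?_⟩
  · rw [val_nsmul]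
    have hd0 : (d : ℝ≥0∞) ≠ 0 := by simp [hd.ne']
    have hz := (ENNReal.lt_div_iff_mul_lt (.inl hd0) (by simp)).1 hz
    refine (ENNReal.mul_le_mul_iff_right hd0 (by simp)).1 ?_
    calc (d : ℝ≥0∞) * ((k + 1 : ℕ) * z.val) = (z.val * d) * (k + 1 : ℕ) := by ring
      _ ≤ c * (k + 1 : ℕ) := mul_le_mul_left hz.le _
      _ ≤ d * p := by
        have : c * (k + 1) ≤ d * p := by simpa using hlt.le
        exact_mod_cast this
  · rw [val_nsmul]
    exact hp

theorem JiangSu.compact_eq_nsmul_one (n : ℕ) : compact n = n • (1 : JiangSu) := by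
  rw [← compact_mul, mul_one]

section Isomorphism

variable {S : Type*} [AddCommMonoid S] [PartialOrder S]

theorem tmul_eq_one_tmul {f : JiangSu → S → S} (hf : IsCuBimorphism f) (hone : ∀ s, f 1 s = s)
    {z : JiangSu} (hz : ¬z.IsSoft) (s : S) : z ⊗ₜ[ℕ] s = 1 ⊗ₜ[ℕ] f z s := by
  rcases z with n | ⟨t, ht⟩
  · rw [JiangSu.compact_eq_nsmul_one, TensorProduct.smul_tmul, hf.nsmul_left, hone]
  · exact (hz trivial).elim

/-- For `z ≪ w`, comparison of `z ⊗ s` with `1 ⊗ w s`: compact elements can be moved across the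
tensor sign, and for soft `w` a compact element between `(k + 1) z` and `k w` reduces the claim to
almost unperforation of `Z ⊗ S`. -/
theorem tensorLE_one_tmul {f : JiangSu → S → S} (hf : IsCuBimorphism f) (hone : ∀ s, f 1 s = s)
    {z w : JiangSu} (h : WayBelow z w) (s : S) :
    TensorLE (z ⊗ₜ[ℕ] s) (1 ⊗ₜ[ℕ] f w s) := by
  by_cases hw : w.IsSoft
  · obtain ⟨k, p, hz, hw⟩ := JiangSu.exists_nsmul_le_compact ((JiangSu.wayBelow_iff.1 h).2 hw)
    refine TensorLE.of_nsmul (k := k) ?_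
    rw [TensorProduct.smul_tmul', ← TensorProduct.tmul_smul, ← hf.nsmul_left]
    refine (TensorLE.tmul hz le_rfl).trans ?_
    rw [tmul_eq_one_tmul hf hone (z := .compact p) id]
    exact .tmul le_rfl (hf.mono_left _ _ _ hw)
  · rw [← tmul_eq_one_tmul hf hone hw]
    exact .tmul h.le le_rfl

theorem one_tmul_tensorLE {f : JiangSu → S → S} (hf : IsCuBimorphism f) (hone : ∀ s, f 1 s = s)
    {z w : JiangSu} (h : WayBelow z w) (s : S) :
    TensorLE (1 ⊗ₜ[ℕ] f z s) (w ⊗ₜ[ℕ] s) := by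
  by_cases hw : w.IsSoft
  · obtain ⟨k, p, hz, hw⟩ := JiangSu.exists_nsmul_le_compact ((JiangSu.wayBelow_iff.1 h).2 hw)
    refine TensorLE.of_nsmul (k := k) ?_
    rw [← TensorProduct.tmul_smul, ← hf.nsmul_left, TensorProduct.smul_tmul']
    refine TensorLE.trans ?_ (.tmul hw le_rfl)
    rw [tmul_eq_one_tmul hf hone (z := .compact p) id]
    exact .tmul le_rfl (hf.mono_left _ _ _ hz)
  · rw [tmul_eq_one_tmul hf hone hw]
    exact .tmul le_rfl (hf.mono_left _ _ _ h.le)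

variable [CuSemigroup S]

/-- With `TensorPrec.one_tmul_le`: up to a `≺`-step, every element of `Z ⊗ S` is an elementary
tensor `1 ⊗ s`. -/
theorem TensorPrec.le_one_tmul {f : JiangSu → S → S} (hf : IsCuBimorphism f)
    (hone : ∀ s, f 1 s = s) {x y : JiangSu ⊗[ℕ] S} (h : TensorPrec x y) :
    TensorLE x (1 ⊗ₜ[ℕ] hf.lift y) := by
  obtain ⟨n, a', a, b', b, ha, hb, h₁, h₂⟩ := h
  refine h₁.trans (TensorLE.trans ?_ (TensorLE.tmul le_rfl (h₂.lift hf)))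
  rw [map_sum, TensorProduct.tmul_sum]
  exact TensorLE.sum fun i => (tensorLE_one_tmul hf hone (ha i) (b' i)).trans
    (.tmul le_rfl (hf.mono_right _ _ _ (hb i).le))

theorem TensorPrec.one_tmul_le {f : JiangSu → S → S} (hf : IsCuBimorphism f)
    (hone : ∀ s, f 1 s = s) {x y : JiangSu ⊗[ℕ] S} (h : TensorPrec x y) :
    TensorLE (1 ⊗ₜ[ℕ] hf.lift x) y := by
  obtain ⟨n, a', a, b', b, ha, hb, h₁, h₂⟩ := h
  refine (TensorLE.tmul le_rfl (h₁.lift hf)).trans (TensorLE.trans ?_ h₂)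
  rw [map_sum, TensorProduct.tmul_sum]
  exact TensorLE.sum fun i => (one_tmul_tensorLE hf hone (ha i) (b' i)).trans
    (.tmul le_rfl (hb i).le)

/-- The sequence `1 ⊗ vₙ` for a rapidly increasing sequence `v`. -/
noncomputable def oneTmulSeq (v : ℕ → S) (hv : ∀ n, WayBelow (v n) (v (n + 1))) :
    TensorSeq JiangSu S where
  seq n := 1 ⊗ₜ v n
  prec_succ n := ⟨1, fun _ => 1, fun _ => 1, fun _ => v n, fun _ => v (n + 1),
    fun _ => JiangSu.wayBelow_iff.2 ⟨le_rfl, fun h => h.elim⟩, fun _ => hv n,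
    by simpa using TensorLE.refl _, by simpa using TensorLE.refl _⟩

theorem oneTmulSeq_le_iff {f : JiangSu → S → S} (hf : IsCuBimorphism f) (hone : ∀ s, f 1 s = s)
    {v w : ℕ → S} (hv : ∀ n, WayBelow (v n) (v (n + 1))) (hw : ∀ n, WayBelow (w n) (w (n + 1)))
    {a b : S} (ha : IsLUB (Set.range v) a) (hb : IsLUB (Set.range w) b) :
    oneTmulSeq v hv ≤ oneTmulSeq w hw ↔ a ≤ b := by
  refine ⟨fun h => ha.2 ?_, fun h => TensorSeq.le_of_forall_tensorLE fun k => ?_⟩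
  · rintro _ ⟨k, rfl⟩
    obtain ⟨n, hn⟩ := h k
    have : f 1 (v k) ≤ f 1 (w n) := hn.le.lift hf
    rw [hone, hone] at this
    exact this.trans (hb.1 ⟨n, rfl⟩)
  · obtain ⟨n, hn⟩ := hv k w b (monotone_nat_of_le_succ fun n => (hw n).le) hb
      ((ha.1 ⟨k + 1, rfl⟩).trans h)
    exact ⟨n, .tmul le_rfl hn⟩

/-- If `S` has `Z`-multiplication, then `s ↦ 1 ⊗ s` is an isomorphism from `S` to its tensor
product with `Z`. -/
theorem HasMultiplication.cuIsomorphic (h : HasMultiplication JiangSu S) :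
    CuIsomorphic S (CuTensor JiangSu S) := by
  obtain ⟨f, hf, -, hone⟩ := h
  choose u hu hlub using CuSemigroup.exists_rapid (S := S)
  have hle := @oneTmulSeq_le_iff S _ _ _ f hf hone
  have heq : ∀ (v : ℕ → S) (hv : ∀ n, WayBelow (v n) (v (n + 1))) (a : S),
      IsLUB (Set.range v) a → CuTensor.mk (oneTmulSeq (u a) (hu a)) =
        CuTensor.mk (oneTmulSeq v hv) := fun v hv a ha =>
    le_antisymm (CuTensor.mk_le_mk.2 ((hle _ _ (hlub a) ha).2 le_rfl))
      (CuTensor.mk_le_mk.2 ((hle _ _ ha (hlub a)).2 le_rfl))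
  let e : S ↪o CuTensor JiangSu S := OrderEmbedding.ofMapLEIff
    (fun s => CuTensor.mk (oneTmulSeq (u s) (hu s))) fun a b => hle _ _ (hlub a) (hlub b)
  have he : Function.Surjective e := by
    intro y
    obtain ⟨x, rfl⟩ := y.exists_mk
    have hv := fun n => (x.prec_succ n).lift hf
    obtain ⟨s, hs⟩ := CuSemigroup.exists_sup _ (monotone_nat_of_le_succ fun n => (hv n).le)
    refine ⟨s, (heq _ hv s hs).trans (le_antisymm ?_ ?_)⟩
    · exact CuTensor.mk_le_mk.2 (TensorSeq.le_of_forall_tensorLE fun k =>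
        ⟨k + 1, (x.prec_succ k).one_tmul_le hf hone⟩)
    · exact CuTensor.mk_le_mk.2 (TensorSeq.le_of_forall_tensorLE fun k =>
        ⟨k + 1, (x.prec_succ k).le_one_tmul hf hone⟩)
  refine CuIsomorphic.of_orderIso (RelIso.ofSurjective e he) ?_ fun a b => ?_
  · refine (heq (fun _ => 0) (fun _ => wayBelow_zero_left 0) 0 (by simp)).trans ?_
    exact congrArg CuTensor.mk (TensorSeq.ext (funext fun n => TensorProduct.tmul_zero _ _))
  · refine (heq (fun n => u a n + u b n) (fun n => (hu a n).add (hu b n)) (a + b)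
      (CuSemigroup.add_sup _ _ _ _ (monotone_nat_of_le_succ fun n => (hu a n).le)
        (monotone_nat_of_le_succ fun n => (hu b n).le) (hlub a) (hlub b))).trans ?_
    exact congrArg CuTensor.mk (TensorSeq.ext (funext fun n => TensorProduct.tmul_add _ _ _))

end Isomorphism

end Cuntz

theorem mainTheorem2 (S : Type*) [AddCommMonoid S] [PartialOrder S] [Cuntz.CuSemigroup S] :
    List.TFAE [
      Cuntz.CuIsomorphic S (Cuntz.CuTensor Cuntz.JiangSu S),
      Cuntz.HasMultiplication Cuntz.JiangSu S,
      Cuntz.AlmostUnperforated S ∧ Cuntz.AlmostDivisible S] := by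
  tfae_have 1 → 3 := fun h =>
    ⟨h.almostUnperforated Cuntz.CuTensor.almostUnperforated, h.almostDivisible⟩
  tfae_have 3 → 2 := fun h => Cuntz.hasMultiplication_jiangSu h.1 h.2
  tfae_have 2 → 1 := fun h => h.cuIsomorphic
  tfae_finish
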